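/- Let $K$ be an algebraically closed field of characteristic $0$, let $\sigma$ be a field automorphism of $K$ of order two, let $R=K^{\sigma}$ be its fixed field, which is real closed, and let $i=\sqrt{-1}$, so that $K=R(i)$. For $z\in K$ put $\Re(z)=\frac{z+\sigma(z)}{2}$ and $\Im(z)=\frac{z-\sigma(z)}{2i}$; for $w\in K^{\times}$ let $|w|$ be the positive square root of $w\,\sigma(w)$ in $R$ and let $\Theta(w)=w/|w|$. Let $\mathbb{G}=\mathbb{G}_a\times\mathbb{G}_m$ over $K$, with projections $\pi_a$ and $\pi_m$ onto its two factors. An integer matrix $M=(m_{k,j})\in\mathcal{M}_{p,n}(\mathbb{Z})$ acts as the homomorphism $\mathbb{G}^n\to\mathbb{G}^p$, $M\cdot(z_j,w_j)_j=\bigl(\sum_j m_{k,j}z_j,\prod_j w_j^{m_{k,j}}\bigr)_k$. The dimension of a subset of $\mathbb{G}^p$ (or of $\mathbb{G}_a$, $\mathbb{G}_m$) is that of its Zariski closure. An absolutely irreducible variety $V\subset\mathbb{G}^n$ is - absolutely free if $\dim\pi_a(M\cdot V)=\dim\pi_m(M\cdot V)=1$ for all non-zero $M\in\mathcal{M}_{1,n}(\mathbb{Z})$;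 - rotund if $\dim M\cdot V\ge\mathrm{rank}\,M$ for all $M\in\mathcal{M}_{n,n}(\mathbb{Z})$; - simple if it is absolutely free and rotund, and $\dim M\cdot V>\mathrm{rank}\,M$ for all $M\in\mathcal{M}_{n,n}(\mathbb{Z})$ with $0<\mathrm{rank}\,M<n$; - perfectly rotund if it is simple and $\dim V=n$. The realisation map $r:\mathbb{G}^n\to\mathbb{G}^{2n}$ sends $(z_j,w_j)_{j}$ to the point whose first $n$ components are $(\Re(z_j),|w_j|)$ and whose last $n$ components are $(i\,\Im(z_j),\Theta(w_j))$. The $\mathbb{G}$-restriction of scalars $\check V$ of $V\subset\mathbb{G}^n$ is the Zariski closure of $r(V)$ in $\mathbb{G}^{2n}$. **Theorem 9.1.** Let $V\subset\mathbb{G}^n$ be an absolutely irreducible simple variety. Then $\check V$ is absolutely free, absolutely irreducible and rotund. Moreover, if $M\in\mathcal{M}_{p,2n}(\mathbb{Z})$ is an integer matrix of rank $p>0$ such that $\dim M\cdot\check V=\mathrm{rank}\,M$, then $V$ is perfectly rotund, and one of the following holds: 1. $\mathrm{rank}\,M=2n$; 2. $\mathrm{rank}\,M=n$, and $M=(N\mid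 P)$ where $N,P\in\mathcal{M}_{n,n}(\mathbb{Z})$ are two square matrices of maximum rank. -/

import Mathlib

noncomputable section

namespace GRes

open MvPolynomial

universe u

/-! ### The group `𝔾 = 𝔾ₐ × 𝔾ₘ` and the action of integer matrices -/

/-- The `K`-points of `𝔾ₐ × 𝔾ₘ`. The factor `Kˣ` is written additively, so that the group law `⊕` is
`+`, and the `ℤ`-module structure is `m • (z, w) = (m z, w ^ m)`. -/
def G (K : Type u) [Field K] : Type u := K × Additive Kˣ

instance (K : Type u) [Field K] : AddCommGroup (G K) :=
  inferInstanceAs (AddCommGroup (K × Additive Kˣ))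

variable {K : Type u} [Field K] {ι κ : Type}

/-- The point `(z, w)` of `𝔾`. -/
def G.mk (z : K) (w : Kˣ) : G K := (z, Additive.ofMul w)

/-- The additive coordinate. -/
def G.add (g : G K) : K := Prod.fst (α := K) (β := Additive Kˣ) g

/-- The multiplicative coordinate. -/
def G.mul (g : G K) : Kˣ := Additive.toMul (Prod.snd (α := K) (β := Additive Kˣ) g)

/-- The action of an integer matrix `M` on `𝔾^ι`,
`(M · (z, w))_i = (∑ j, M i j * z j, ∏ j, w j ^ M i j)`. -/
def matAct [Fintype ι] (M : Matrix κ ι ℤ) (v : ι → G K) : κ → G K :=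
  fun i => ∑ j, M i j • v j

theorem matAct_add [Fintype ι] (M : Matrix κ ι ℤ) (v : ι → G K) (i : κ) :
    (matAct M v i).add = ∑ j, (M i j : K) * (v j).add := by
  have h : (matAct M v i).add = ∑ j, (M i j • v j).add :=
    map_sum (AddMonoidHom.fst K (Additive Kˣ)) (fun j => M i j • v j) Finset.univ
  rw [h]
  refine Finset.sum_congr rfl fun j _ => ?_
  rw [← zsmul_eq_mul]
  rfl

theorem matAct_mul [Fintype ι] (M : Matrix κ ι ℤ) (v : ι → G K) (i : κ) :
    (matAct M v i).mul = ∏ j, (v j).mul ^ (M i j) := by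
  have h : (matAct M v i).mul = ∏ j, (M i j • v j).mul :=
    congrArg Additive.toMul
      (map_sum (AddMonoidHom.snd K (Additive Kˣ)) (fun j => M i j • v j) Finset.univ)
  rw [h]
  rfl

/-! ### Zariski topology and dimension -/

/-- The embedding of `𝔾^ι` as a principal open subset of an affine space. -/
def coord (v : ι → G K) : ι ⊕ ι → K :=
  Sum.elim (fun j => (v j).add) (fun j => ((v j).mul : K))

/-- The Zariski topology on `𝔾^ι`: the closed sets are the sets of common zeros in `𝔾^ι` of the
polynomials, in the `2 |ι|` coordinates, of an ideal. -/
instance zariski : TopologicalSpace (ι → G K) :=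
  TopologicalSpace.ofClosed
    {Z | ∃ I : Ideal (MvPolynomial (ι ⊕ ι) K), Z = coord ⁻¹' zeroLocus K I}
    ⟨⊤, by simp⟩
    (by
      intro A hA
      have hA' : ∀ Z ∈ A, ∃ I : Ideal (MvPolynomial (ι ⊕ ι) K), Z = coord ⁻¹' zeroLocus K I :=
        fun Z hZ => hA hZ
      choose! I hI using hA'
      refine ⟨⨆ Z ∈ A, I Z, ?_⟩
      ext v
      have key : coord v ∈ zeroLocus K (⨆ Z ∈ A, I Z) ↔
          ∀ Z ∈ A, coord v ∈ zeroLocus K (I Z) := by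
        have e : ∀ J : Ideal (MvPolynomial (ι ⊕ ι) K), coord v ∈ zeroLocus K J ↔
            J ≤ vanishingIdeal K {coord v} := by
          intro J
          rw [← le_zeroLocus_iff_le_vanishingIdeal]
          simp
        simp only [e, iSup_le_iff]
      simp only [Set.mem_sInter, Set.mem_preimage, key]
      refine forall₂_congr fun Z hZ => ?_
      conv_lhs => rw [hI Z hZ]
      rfl)
    (by
      rintro _ ⟨I, rfl⟩ _ ⟨J, rfl⟩
      refine ⟨I * J, ?_⟩
      ext v
      simp only [Set.mem_union, Set.mem_preimage, mem_zeroLocus_iff]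
      constructor
      · intro h p hp
        refine Submodule.mul_induction_on hp (fun a ha b hb => ?_) (fun a b ha hb => ?_)
        · rcases h with h | h
          · rw [map_mul, h a ha, zero_mul]
          · rw [map_mul, h b hb, mul_zero]
        · rw [map_add, ha, hb, add_zero]
      · intro h
        by_contra! hc
        obtain ⟨⟨a, ha, ha'⟩, b, hb, hb'⟩ := hc
        have h0 := h _ (Ideal.mul_mem_mul ha hb)
        rw [map_mul] at h0
        exact mul_ne_zero ha' hb' h0)

theorem isClosed_iff (Z : Set (ι → G K)) :
    IsClosed Z ↔ ∃ I : Ideal (MvPolynomial (ι ⊕ ι) K), Z = coord ⁻¹' zeroLocus K I := by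
  rw [← isOpen_compl_iff]
  change Zᶜᶜ ∈ _ ↔ _
  rw [compl_compl]
  rfl

/-- The dimension of (the Zariski closure of) a non-empty subset `S` of the affine space `K^τ`: the
transcendence degree over `K` of its ring of regular functions `K[x_t : t ∈ τ] / I(S)`. -/
def affDim {τ : Type} (S : Set (τ → K)) : ℕ :=
  Cardinal.toNat (Algebra.trdeg K (MvPolynomial τ K ⧸ vanishingIdeal K S))

/-- The transcendence degree is finite, so that no information is lost in `affDim`. -/
theorem affDim_eq {τ : Type} [Finite τ] (S : Set (τ → K)) :
    (affDim S : Cardinal) = Algebra.trdeg K (MvPolynomial τ K ⧸ vanishingIdeal K S) :=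
  Cardinal.cast_toNat_of_lt_aleph0 trdeg_lt_aleph0_of_finiteType

/-- The dimension of a non-empty subset of `𝔾^ι` (meaning that of its Zariski closure). -/
def dim (S : Set (ι → G K)) : ℕ := affDim (coord '' S)

/-! ### Varieties, absolute freeness, rotundity -/

/-- `V` is (the set of `K`-points of) an absolutely irreducible subvariety of `𝔾^ι`, for `K`
algebraically closed. -/
def IsAbsIrreducibleVariety (V : Set (ι → G K)) : Prop :=
  IsClosed V ∧ IsIrreducible V

/-- `π_a : 𝔾^κ → 𝔾ₐ^κ`. -/
def piA (v : κ → G K) : κ → K := fun j => (v j).add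

/-- `π_m : 𝔾^κ → 𝔾ₘ^κ`, as a subset of affine space. -/
def piM (v : κ → G K) : κ → K := fun j => ((v j).mul : K)

/-- For all non-zero integer row vectors `M`, both projections of `M · V ⊆ 𝔾` have dimension
one. -/
def IsAbsolutelyFree [Fintype ι] (V : Set (ι → G K)) : Prop :=
  ∀ M : Matrix (Fin 1) ι ℤ, M ≠ 0 →
    affDim (piA '' (matAct M '' V)) = 1 ∧ affDim (piM '' (matAct M '' V)) = 1

def IsRotund [Fintype ι] (V : Set (ι → G K)) : Prop :=
  ∀ M : Matrix ι ι ℤ, M.rank ≤ dim (matAct M '' V)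

/-- Simple varieties. -/
def IsSimple [Fintype ι] (V : Set (ι → G K)) : Prop :=
  IsAbsolutelyFree V ∧ IsRotund V ∧
    ∀ M : Matrix ι ι ℤ, 0 < M.rank → M.rank < Fintype.card ι → M.rank < dim (matAct M '' V)

/-- The depth `δ(V) = dim V - n` of `V ⊆ 𝔾^n`. -/
def depth [Fintype ι] (V : Set (ι → G K)) : ℤ := (dim V : ℤ) - Fintype.card ι

def IsPerfectlyRotund [Fintype ι] (V : Set (ι → G K)) : Prop :=
  IsSimple V ∧ depth V = 0

/-! ### The realisation map

Here `σ` is an automorphism of order two of the algebraically closed field `K` of characteristic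
zero, and `R` is its fixed field, a real closed field. -/

/-- `x` is a positive element of the fixed field `R` of `σ`, i.e. the square of a non-zero element
of `R`. -/
def IsPos (σ : K ≃+* K) (x : K) : Prop :=
  ∃ t : K, t ≠ 0 ∧ σ t = t ∧ x = t ^ 2

/-- The real part `(z + σ z) / 2`. -/
def realPart (σ : K ≃+* K) (z : K) : K := (z + σ z) / 2

/-- `i` times the imaginary part `(z - σ z) / (2 i)`. -/
def iImagPart (σ : K ≃+* K) (z : K) : K := (z - σ z) / 2

/-- The modulus: the positive square root in `R` of `w * σ w`. -/
def modulus (σ : K ≃+* K) (w : Kˣ) : Kˣ :=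
  Classical.epsilon fun ρ : Kˣ => IsPos σ (ρ : K) ∧ (ρ : K) ^ 2 = (w : K) * σ (w : K)

theorem map_I [IsAlgClosed K] [CharZero K] {σ : K ≃+* K} (hσ : ∀ x, σ (σ x) = x)
    (hne : ∃ x, σ x ≠ x) {i : K} (hi : i ^ 2 = -1) : σ i = -i := by
  have h1 : σ i = i ∨ σ i = -i := by
    apply sq_eq_sq_iff_eq_or_eq_neg.mp
    rw [← map_pow, hi, map_neg, map_one]
  rcases h1 with h1 | h1
  · exfalso
    obtain ⟨b, hb⟩ := hne
    obtain ⟨c, hc⟩ := IsAlgClosed.exists_pow_nat_eq (b - σ b) (n := 2) (by norm_num)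
    have hc0 : c ≠ 0 := by
      rintro rfl
      apply hb
      have : b - σ b = 0 := by rw [← hc]; ring
      exact (sub_eq_zero.mp this).symm
    have h2 : σ c ^ 2 = (i * c) ^ 2 := by
      rw [← map_pow, mul_pow, hc, hi, map_sub, hσ]; ring
    have h3 : σ (σ c) = i * (i * c) := by
      rcases sq_eq_sq_iff_eq_or_eq_neg.mp h2 with h | h
      · rw [h, map_mul, h1, h]
      · rw [h, map_neg, map_mul, h1, h]; ring
    rw [hσ] at h3
    have h4 : 2 * c = 0 := by linear_combination h3 + c * hi
    simp [hc0] at h4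
  · exact h1

/-- The defining property of the modulus. -/
theorem modulus_spec [IsAlgClosed K] [CharZero K] {σ : K ≃+* K} (hσ : ∀ x, σ (σ x) = x)
    (hne : ∃ x, σ x ≠ x) (w : Kˣ) :
    IsPos σ (modulus σ w : K) ∧ (modulus σ w : K) ^ 2 = (w : K) * σ (w : K) := by
  refine Classical.epsilon_spec
    (p := fun ρ : Kˣ => IsPos σ (ρ : K) ∧ (ρ : K) ^ 2 = (w : K) * σ (w : K)) ?_
  obtain ⟨i, hi⟩ := IsAlgClosed.exists_pow_nat_eq (-1 : K) (n := 2) (by norm_num)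
  have hI := map_I hσ hne hi
  obtain ⟨v, hv⟩ := IsAlgClosed.exists_pow_nat_eq (w : K) (n := 2) (by norm_num)
  obtain ⟨c, hc⟩ := IsAlgClosed.exists_pow_nat_eq (v * σ v) (n := 2) (by norm_num)
  have hw : (w : K) ≠ 0 := w.ne_zero
  have hv0 : v ≠ 0 := by
    rintro rfl
    apply hw
    rw [← hv]; ring
  have hc0 : c ≠ 0 := by
    rintro rfl
    have : v * σ v = 0 := by rw [← hc]; ring
    simp [hv0] at this
  have hn : (v * σ v) ^ 2 = (w : K) * σ (w : K) := by
    rw [← hv, map_pow]; ring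
  have hsc : σ c = c ∨ σ c = -c := by
    apply sq_eq_sq_iff_eq_or_eq_neg.mp
    rw [← map_pow, hc, map_mul, hσ]; ring
  rcases hsc with h | h
  · refine ⟨Units.mk0 (c ^ 2) (pow_ne_zero _ hc0), ⟨c, hc0, h, rfl⟩, ?_⟩
    rw [Units.val_mk0, hc, hn]
  · have hi0 : i ≠ 0 := by
      rintro rfl
      norm_num at hi
    refine ⟨Units.mk0 ((i * c) ^ 2) (pow_ne_zero _ (mul_ne_zero hi0 hc0)),
      ⟨i * c, mul_ne_zero hi0 hc0, by rw [map_mul, hI, h]; ring, rfl⟩, ?_⟩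
    rw [Units.val_mk0, mul_pow, hc, hi, ← hn]; ring

/-- Uniqueness of the modulus. -/
theorem modulus_unique [IsAlgClosed K] [CharZero K] {σ : K ≃+* K} (hσ : ∀ x, σ (σ x) = x)
    (hne : ∃ x, σ x ≠ x) (w ρ : Kˣ) (hρ : IsPos σ (ρ : K))
    (h : (ρ : K) ^ 2 = (w : K) * σ (w : K)) : ρ = modulus σ w := by
  obtain ⟨⟨s, hs0, hs, hs'⟩, h2⟩ := modulus_spec hσ hne w
  obtain ⟨t, ht0, ht, ht'⟩ := hρ
  rcases sq_eq_sq_iff_eq_or_eq_neg.mp (h.trans h2.symm) with e | e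
  · exact Units.ext e
  · exfalso
    have hi : (t / s) ^ 2 = -1 := by
      rw [div_pow, ← ht', e, hs', neg_div, div_self (pow_ne_zero 2 hs0)]
    have h3 := map_I hσ hne hi
    rw [map_div₀, hs, ht] at h3
    have h4 : t / s = 0 := self_eq_neg.mp h3
    simp [ht0, hs0] at h4

/-- The phase `w / |w|`. -/
def phase (σ : K ≃+* K) (w : Kˣ) : Kˣ := w / modulus σ w

/-- The realisation map `r : 𝔾^n → 𝔾^(2n)`,
`(z, w) ↦ (Re z, |w|) × (i Im z, Θ(w))`; the first copy of `ι` indexes the real components, the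
second one the imaginary components. -/
def realise (σ : K ≃+* K) (v : ι → G K) : ι ⊕ ι → G K :=
  Sum.elim (fun j => G.mk (realPart σ (v j).add) (modulus σ (v j).mul))
    (fun j => G.mk (iImagPart σ (v j).add) (phase σ (v j).mul))

/-- The `𝔾`-restriction of scalars: the Zariski closure of the realisation `r(V)` in `𝔾^(2n)`. -/
def gRestriction (σ : K ≃+* K) (V : Set (ι → G K)) : Set (ι ⊕ ι → G K) :=
  closure (realise σ '' V)

end GRes

end

noncomputable section

namespace GRes

/-! Halving turns the realisation map into an algebraic isogeny. If `v = 2x`, then `|w ^ 2| = w * σ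
w` and the phase of `w ^ 2` is `w / σ w`, so that `r(v) = (x + x̄, x - x̄)` with `x̄ = conj σ x`
(`realise_two_nsmul`). Lying over for the doubling map gives an irreducible `W` with `2W = V`
(`exists_isIrred_double`), so `r(V)` is the image of the graph of conjugation on `W` under `(x, y) ↦
(x + y, x - y)`. This graph is Zariski dense in `W × W̄` (`regular_eq_zero_of_graph`): Noether
normalisation reduces this to affine space, where it is the density of `{(t, σ t)}`. Hence the
restriction of scalars is the closure of an isogenous image of `W × W̄`. Irreducibility and freeness
follow, since `W` and `W̄` inherit freeness and the dimension bounds from `V`.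

For `M = (N | P)` put `A = N + P` and `B = N - P`. Up to closure, `M` maps the restriction of
scalars to `A·W + B·W̄`. If `E` projects along the range of `A`, applying `E` to the sum retains
only the `W̄` part, whence the dimension is at least `dim A·W + dim EB·W̄ ≥ rank A + rank EB ≥ rank
(A | B) ≥ rank M` (`IsIrred.dim_add_dim_le`). This is rotundity.

If `M` has full row rank and equality holds, all these inequalities are equalities, and simplicity
forces `A`, `B` and `EB` to have rank `0` or `n`. Either the rank is `2n`, or one of `A`, `B`
vanishes and `N = ±P` has rank `n`, or `A` and `B` both have rank `n = rank M`. The last case is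
impossible: adding an irreducible free set to an irreducible subset of `𝔾^n` of dimension at least
`n` gives dimension greater than `n` (`IsIrred.card_lt_dim_image2_add`). Otherwise the functions
vanishing on the first summand would also vanish on progressions `x + k • s` with generic `s`, and
the independence of the exponential polynomials `p(k) α ^ k` would make `n + 1` coordinates
independent. In the surviving cases some matrix of rank `n` maps `V` to dimension at most `n`, hence
`dim V = n`. -/

/-! ### Ranks of integer matrices -/

/-- An integer matrix with its entries seen as rational numbers. -/
def toRat {κ ι : Type*} (C : Matrix κ ι ℤ) : Matrix κ ι ℚ := C.map (Int.castRingHom ℚ)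

theorem toRat_mul {κ ι o : Type*} [Fintype ι] (A : Matrix κ ι ℤ) (B : Matrix ι o ℤ) :
    toRat (A * B) = toRat A * toRat B :=
  Matrix.map_mul

theorem toRat_injective {κ ι : Type*} : Function.Injective (toRat : Matrix κ ι ℤ → _) :=
  Matrix.map_injective Int.cast_injective

/-- The rational column span is the localisation of the integral one at the non-zero integers, and
localisation preserves `finrank`. -/
theorem rank_toRat {κ ι : Type*} [Fintype κ] [Fintype ι] (C : Matrix κ ι ℤ) :
    (toRat C).rank = C.rank := by
  let f : (κ → ℤ) →ₗ[ℤ] (κ → ℚ) := .pi fun i => Algebra.linearMap ℤ ℚ ∘ₗ .proj i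
  have : IsLocalizedModule (nonZeroDivisors ℤ) f := inferInstance
  rw [Matrix.rank_eq_finrank_span_cols, Matrix.rank_eq_finrank_span_cols]
  have h : Submodule.span ℚ (Set.range (toRat C).col) =
      (Submodule.span ℤ (Set.range C.col)).localized' ℚ (nonZeroDivisors ℤ) f := by
    rw [Submodule.localized'_span, ← Set.range_comp]
    rfl
  rw [h, IsLocalization.finrank_eq ℚ (nonZeroDivisors ℤ) le_rfl,
    IsLocalizedModule.finrank_eq (nonZeroDivisors ℤ)
      ((Submodule.span ℤ (Set.range C.col)).toLocalized' ℚ (nonZeroDivisors ℤ) f) le_rfl]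

/-- Makes it possible to replace a rectangular matrix by a square one of equal rank; over `ℚ` this
rests on positivity of sums of squares. -/
theorem rank_transpose_mul_self_int {κ ι : Type*} [Fintype κ] [Fintype ι] (C : Matrix κ ι ℤ) :
    (C.transpose * C).rank = C.rank := by
  have h : toRat C.transpose = (toRat C).transpose := rfl
  rw [← rank_toRat, toRat_mul, h, Matrix.rank_transpose_mul_self, rank_toRat]

theorem det_ne_zero_of_rank_eq {ι : Type*} [Fintype ι] [DecidableEq ι] {C : Matrix ι ι ℤ}
    (h : C.rank = Fintype.card ι) : C.det ≠ 0 := by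
  have h1 : LinearMap.range (toRat C).mulVecLin = ⊤ := by
    apply Submodule.eq_top_of_finrank_eq
    rw [Module.finrank_fintype_fun_eq_card, ← h, ← rank_toRat]
    rfl
  have h2 : IsUnit (toRat C) :=
    Matrix.mulVec_surjective_iff_isUnit.1 (LinearMap.range_eq_top.1 h1)
  have h3 : (toRat C).det = (C.det : ℚ) := ((Int.castRingHom ℚ).map_det C).symm
  have h4 := ((Matrix.isUnit_iff_isUnit_det _).1 h2).ne_zero
  rw [h3] at h4
  exact_mod_cast h4

theorem exists_leftInverse_of_rank_eq {κ ι : Type*} [Fintype κ] [Fintype ι] [DecidableEq ι]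
    (C : Matrix κ ι ℤ) (h : C.rank = Fintype.card ι) :
    ∃ (D : Matrix ι κ ℤ) (d : ℕ), d ≠ 0 ∧ D * C = (d : ℤ) • 1 := by
  have h1 := det_ne_zero_of_rank_eq ((rank_transpose_mul_self_int C).trans h)
  -- Cramer's rule for the Gram matrix; the sign makes the resulting scalar a natural number.
  refine ⟨(C.transpose * C).det.sign • ((C.transpose * C).adjugate * C.transpose),
    (C.transpose * C).det.natAbs, Int.natAbs_ne_zero.2 h1, ?_⟩
  rw [Matrix.smul_mul, Matrix.mul_assoc, Matrix.adjugate_mul, smul_smul,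
      Int.sign_mul_self_eq_natAbs]

/-- Let `E` be the projection onto a complement of the range of `A`, along that range. Each column
`b` of `B` differs from `E b` by an element of the range of `A`, so the range of `(A | B)` lies in
the sum of the ranges of `A` and `E * B`. -/
theorem exists_mul_eq_zero_rank_fromCols_le {F κ ι ι' : Type*} [Field F] [Fintype κ] [Fintype ι]
    [Fintype ι'] [DecidableEq κ] (A : Matrix κ ι F) (B : Matrix κ ι' F) :
    ∃ E : Matrix κ κ F, E * A = 0 ∧ (Matrix.fromCols A B).rank ≤ A.rank + (E * B).rank := by
  classical
  obtain ⟨W, hW⟩ := Submodule.exists_isCompl (LinearMap.range A.mulVecLin)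
  let g := W.projection _ hW.symm
  have hker : LinearMap.ker g = LinearMap.range A.mulVecLin := Submodule.ker_projection _
  have hmv : ∀ v, (LinearMap.toMatrix' g).mulVec v = g v := fun v => by
    rw [← Matrix.toLin'_apply, Matrix.toLin'_toMatrix']
  refine ⟨LinearMap.toMatrix' g, ?_, ?_⟩
  · apply Matrix.toLin'.injective
    refine LinearMap.ext fun v => ?_
    rw [Matrix.toLin'_mul, LinearMap.comp_apply, Matrix.toLin'_toMatrix', map_zero,
      LinearMap.zero_apply, ← LinearMap.mem_ker, hker]
    exact ⟨v, rfl⟩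
  · refine le_trans (Submodule.finrank_mono ?_) (Submodule.finrank_add_le_finrank_add_finrank
      (LinearMap.range A.mulVecLin) (LinearMap.range (LinearMap.toMatrix' g * B).mulVecLin))
    rintro _ ⟨v, rfl⟩
    rw [Matrix.mulVecLin_apply, ← Sum.elim_comp_inl_inr v, Matrix.fromCols_mulVec_sumElim]
    refine add_mem (Submodule.mem_sup_left ⟨_, rfl⟩) ?_
    set b := B.mulVec (v ∘ Sum.inr) with hb
    rw [← sub_add_cancel b (g b)]
    refine add_mem (Submodule.mem_sup_left ?_) (Submodule.mem_sup_right ⟨v ∘ Sum.inr, ?_⟩)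
    · rw [← hker, LinearMap.mem_ker, map_sub, sub_eq_zero]
      exact (LinearMap.congr_fun (Submodule.isIdempotentElem_projection hW.symm) b).symm
    · rw [Matrix.mulVecLin_apply, ← Matrix.mulVec_mulVec, hmv]

/-- Clearing the denominators of the rational projection changes neither its kernel nor the ranks.
-/
theorem exists_int_mul_eq_zero_rank_fromCols_le {κ ι ι' : Type*} [Fintype κ] [Fintype ι]
    [Fintype ι'] [DecidableEq κ] (A : Matrix κ ι ℤ) (B : Matrix κ ι' ℤ) :
    ∃ E : Matrix κ κ ℤ, E * A = 0 ∧ (Matrix.fromCols A B).rank ≤ A.rank + (E * B).rank := by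
  obtain ⟨E, hE, h⟩ := exists_mul_eq_zero_rank_fromCols_le (toRat A) (toRat B)
  obtain ⟨⟨d, hd⟩, hdE⟩ := IsLocalization.exist_integer_multiples_of_finite (nonZeroDivisors ℤ)
    fun p : κ × κ => E p.1 p.2
  choose E' hE' using hdE
  have hd0 : (d : ℚ) ≠ 0 := by exact_mod_cast nonZeroDivisors.ne_zero hd
  have hmap : toRat (Matrix.of fun i j => E' (i, j)) = (d : ℚ) • E := by
    ext i j
    have := hE' (i, j)
    simp only [zsmul_eq_mul] at this
    exact this
  refine ⟨Matrix.of fun i j => E' (i, j), ?_, ?_⟩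
  · apply toRat_injective
    rw [toRat_mul, hmap, Matrix.smul_mul, hE, smul_zero]
    ext
    simp [toRat]
  · have hc : toRat (Matrix.fromCols A B) = Matrix.fromCols (toRat A) (toRat B) :=
      Matrix.fromCols_map ..
    rw [← rank_toRat, ← rank_toRat A, ← rank_toRat (_ * B), toRat_mul, hmap, Matrix.smul_mul,
      Matrix.rank_smul_of_mem_nonZeroDivisors _ (mem_nonZeroDivisors_of_ne_zero hd0), hc]
    exact h

theorem eq_zero_of_rank_eq_zero {κ ι : Type*} [Fintype κ] [Fintype ι] {A : Matrix κ ι ℤ}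
    (h : A.rank = 0) : A = 0 := by
  classical
  have h1 : A.mulVecLin = 0 := LinearMap.range_eq_bot.1 (Submodule.finrank_eq_zero.1 h)
  ext i j
  simpa using congrFun (LinearMap.congr_fun h1 (Pi.single j 1)) i

theorem rank_fromCols_comm {κ ι ι' : Type*} [Fintype ι] [Fintype ι'] (A : Matrix κ ι ℤ)
    (B : Matrix κ ι' ℤ) : (Matrix.fromCols A B).rank = (Matrix.fromCols B A).rank := by
  have : Matrix.fromCols A B =
      (Matrix.fromCols B A).submatrix (Equiv.refl κ) (Equiv.sumComm ι ι') := by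
    ext i (j | j) <;> rfl
  rw [this, Matrix.rank_submatrix]

theorem rank_fromCols_le_fromCols_add_sub {κ ι : Type*} [Fintype ι] (N P : Matrix κ ι ℤ) :
    (Matrix.fromCols N P).rank ≤ (Matrix.fromCols (N + P) (N - P)).rank := by
  classical
  have h : (2 : ℤ) • Matrix.fromCols N P =
      Matrix.fromCols (N + P) (N - P) *
        (Matrix.fromBlocks 1 1 1 (-1) : Matrix (ι ⊕ ι) (ι ⊕ ι) ℤ) := by
    rw [Matrix.fromCols_mul_fromBlocks]
    ext i (j | j) <;> simp <;> ring
  rw [← Matrix.rank_smul_of_mem_nonZeroDivisors (Matrix.fromCols N P)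
    (mem_nonZeroDivisors_of_ne_zero (two_ne_zero (α := ℤ))), h]
  exact Matrix.rank_mul_le_left _ _

open MvPolynomial

universe u

variable {K : Type u} [Field K] {ι κ : Type}

/-! ### Coordinates of sums and multiples -/

theorem G.ext {g h : G K} (ha : g.add = h.add) (hm : g.mul = h.mul) : g = h :=
  Prod.ext ha hm

@[simp] theorem G.add_mk (z : K) (w : Kˣ) : (G.mk z w).add = z := rfl

@[simp] theorem G.mul_mk (z : K) (w : Kˣ) : (G.mk z w).mul = w := rfl

@[simp] theorem G.add_add (g h : G K) : (g + h).add = g.add + h.add := rfl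

@[simp] theorem G.mul_add (g h : G K) : (g + h).mul = g.mul * h.mul := rfl

@[simp] theorem G.add_sub (g h : G K) : (g - h).add = g.add - h.add := rfl

@[simp] theorem G.mul_sub (g h : G K) : (g - h).mul = g.mul / h.mul := rfl

@[simp] theorem G.add_nsmul (k : ℕ) (g : G K) : (k • g).add = k * g.add := by
  rw [← nsmul_eq_mul]; rfl

@[simp] theorem G.mul_nsmul (k : ℕ) (g : G K) : (k • g).mul = g.mul ^ k := rfl

@[simp] theorem coord_inl (v : ι → G K) (j : ι) : coord v (Sum.inl j) = (v j).add := rfl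

@[simp] theorem coord_inr (v : ι → G K) (j : ι) : coord v (Sum.inr j) = ((v j).mul : K) := rfl

theorem matAct_mul_mat {o : Type} [Fintype ι] [Fintype κ] (E : Matrix o κ ℤ) (M : Matrix κ ι ℤ)
    (v : ι → G K) : matAct (E * M) v = matAct E (matAct M v) := by
  funext i
  simp only [matAct, Matrix.mul_apply, Finset.sum_smul, Finset.smul_sum, mul_smul]
  exact Finset.sum_comm

theorem matAct_add_vec [Fintype ι] (M : Matrix κ ι ℤ) (v w : ι → G K) :
    matAct M (v + w) = matAct M v + matAct M w := by
  funext i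
  simp [matAct, Finset.sum_add_distrib]

theorem matAct_sub_vec [Fintype ι] (M : Matrix κ ι ℤ) (v w : ι → G K) :
    matAct M (v - w) = matAct M v - matAct M w := by
  funext i
  simp [matAct, smul_sub, Finset.sum_sub_distrib]

theorem matAct_add_mat [Fintype ι] (M N : Matrix κ ι ℤ) (v : ι → G K) :
    matAct (M + N) v = matAct M v + matAct N v := by
  funext i
  simp [matAct, add_smul, Finset.sum_add_distrib]

theorem matAct_sub_mat [Fintype ι] (M N : Matrix κ ι ℤ) (v : ι → G K) :
    matAct (M - N) v = matAct M v - matAct N v := by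
  funext i
  simp [matAct, sub_smul, Finset.sum_sub_distrib]

@[simp] theorem matAct_zero_mat [Fintype ι] (v : ι → G K) :
    matAct (0 : Matrix κ ι ℤ) v = 0 := by
  funext i
  simp [matAct]

theorem matAct_smul_one [Fintype ι] [DecidableEq ι] (d : ℤ) (v : ι → G K) :
    matAct (d • (1 : Matrix ι ι ℤ)) v = d • v := by
  funext i
  simp [matAct, Matrix.one_apply]

theorem matAct_fromCols {κ' : Type} [Fintype ι] [Fintype κ'] (N : Matrix κ ι ℤ)
    (P : Matrix κ κ' ℤ) (x : ι → G K) (y : κ' → G K) :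
    matAct (Matrix.fromCols N P) (Sum.elim x y) = matAct N x + matAct P y := by
  funext i
  simp [matAct]

/-! ### Regular functions -/

/-- The product of the multiplicative coordinates. -/
def mulProd [Fintype ι] (v : ι → G K) : K := ∏ j, ((v j).mul : K)

theorem mulProd_ne_zero [Fintype ι] (v : ι → G K) : mulProd v ≠ 0 :=
  Finset.prod_ne_zero_iff.2 fun j _ => (v j).mul.ne_zero

/-- The polynomial defining `mulProd`. -/
def mulProdPoly (K : Type u) [Field K] (ι : Type) [Fintype ι] : MvPolynomial (ι ⊕ ι) K :=
  ∏ j, X (Sum.inr j)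

@[simp] theorem eval_mulProdPoly [Fintype ι] (v : ι → G K) :
    eval (coord v) (mulProdPoly K ι) = mulProd v := by
  simp [mulProdPoly, mulProd]

/-- The algebra of regular functions on `𝔾^ι`. -/
def regular (K : Type u) [Field K] (ι : Type) [Fintype ι] : Subalgebra K ((ι → G K) → K) where
  carrier := {φ | ∃ N : ℕ, ∃ F : MvPolynomial (ι ⊕ ι) K, ∀ v,
    mulProd v ^ N * φ v = eval (coord v) F}
  mul_mem' := by
    rintro φ ψ ⟨N, F, h⟩ ⟨N', F', h'⟩
    refine ⟨N + N', F * F', fun v => ?_⟩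
    rw [map_mul, ← h, ← h', Pi.mul_apply]
    ring
  add_mem' := by
    rintro φ ψ ⟨N, F, h⟩ ⟨N', F', h'⟩
    refine ⟨N + N', mulProdPoly K ι ^ N' * F + mulProdPoly K ι ^ N * F', fun v => ?_⟩
    rw [map_add, map_mul, map_mul, map_pow, map_pow, ← h, ← h', Pi.add_apply, eval_mulProdPoly]
    ring
  algebraMap_mem' r := ⟨0, C r, fun v => by simp⟩

theorem aeval_pi_apply {X τ : Type*} (f : τ → X → K) (F : MvPolynomial τ K) (x : X) :
    aeval f F x = eval (fun t => f t x) F := by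
  induction F using MvPolynomial.induction_on with
  | C a => simp
  | add p q hp hq => simp [hp, hq]
  | mul_X p t hp => simp [hp]

/-- A polynomial in regular functions is regular; the induction avoids handling the exponents of the
denominators. -/
theorem eval_mem_regular [Fintype ι] {τ : Type*} {f : τ → (ι → G K) → K}
    (hf : ∀ t, f t ∈ regular K ι) (F : MvPolynomial τ K) :
    (fun v => eval (fun t => f t v) F) ∈ regular K ι := by
  induction F using MvPolynomial.induction_on with
  | C a =>
    simp only [eval_C]
    exact (regular K ι).algebraMap_mem a
  | add p q hp hq =>
    simp only [map_add]
    exact add_mem hp hq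
  | mul_X p t hp =>
    simp only [map_mul, eval_X]
    exact mul_mem hp (hf t)

theorem coord_mem_regular [Fintype ι] (t : ι ⊕ ι) : (fun v : ι → G K => coord v t) ∈ regular K ι :=
  ⟨0, X t, fun v => by simp⟩

theorem add_mem_regular [Fintype ι] (j : ι) : (fun v : ι → G K => (v j).add) ∈ regular K ι :=
  coord_mem_regular (Sum.inl j)

theorem mul_mem_regular [Fintype ι] (j : ι) :
    (fun v : ι → G K => ((v j).mul : K)) ∈ regular K ι :=
  coord_mem_regular (Sum.inr j)

theorem poly_mem_regular [Fintype ι] (F : MvPolynomial (ι ⊕ ι) K) :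
    (fun v : ι → G K => eval (coord v) F) ∈ regular K ι :=
  ⟨0, F, fun v => by simp⟩

theorem const_mem_regular [Fintype ι] (c : K) : (fun _ : ι → G K => c) ∈ regular K ι :=
  (regular K ι).algebraMap_mem c

theorem inv_mem_regular [Fintype ι] (j : ι) :
    (fun v : ι → G K => (((v j).mul⁻¹ : Kˣ) : K)) ∈ regular K ι := by
  classical
  refine ⟨1, ∏ k ∈ Finset.univ.erase j, X (Sum.inr k), fun v => ?_⟩
  rw [pow_one, mulProd, ← Finset.mul_prod_erase _ _ (Finset.mem_univ j), mul_right_comm,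
    Units.mul_inv, one_mul, map_prod]
  simp

theorem zpow_mem_regular [Fintype ι] (j : ι) (m : ℤ) :
    (fun v : ι → G K => (((v j).mul ^ m : Kˣ) : K)) ∈ regular K ι := by
  cases m with
  | ofNat m =>
    simpa [Pi.pow_def] using pow_mem (mul_mem_regular (K := K) j) m
  | negSucc m =>
    have := pow_mem (inv_mem_regular (K := K) j) (m + 1)
    have e : (fun v : ι → G K => (((v j).mul ^ (Int.negSucc m) : Kˣ) : K)) =
        (fun v : ι → G K => (((v j).mul⁻¹ : Kˣ) : K)) ^ (m + 1) := by
      funext v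
      rw [zpow_negSucc, Pi.pow_apply, ← Units.val_pow_eq_pow_val, inv_pow]
    rw [e]
    exact this

/-- Morphisms between powers of `𝔾`. -/
def IsRegularMap [Fintype ι] (h : (ι → G K) → κ → G K) : Prop :=
  ∀ k, (fun v => (h v k).add) ∈ regular K ι ∧ (fun v => ((h v k).mul : K)) ∈ regular K ι ∧
    (fun v => (((h v k).mul⁻¹ : Kˣ) : K)) ∈ regular K ι

/-- The denominator of `φ` pulls back to a product of multiplicative components, which
`IsRegularMap` requires to have regular inverses. -/
theorem IsRegularMap.comp_mem [Fintype ι] [Fintype κ] {h : (ι → G K) → κ → G K}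
    (hh : IsRegularMap h) {φ : (κ → G K) → K} (hφ : φ ∈ regular K κ) :
    (fun v => φ (h v)) ∈ regular K ι := by
  obtain ⟨N, F, hF⟩ := hφ
  have e : (fun v => φ (h v)) = (∏ k, fun v => (((h v k).mul⁻¹ : Kˣ) : K)) ^ N *
      fun v => eval (fun t => coord (h v) t) F := by
    funext v
    have h1 : (∏ k, (((h v k).mul⁻¹ : Kˣ) : K)) * mulProd (h v) = 1 := by
      rw [mulProd, ← Finset.prod_mul_distrib]
      simp
    rw [Pi.mul_apply, Pi.pow_apply, Finset.prod_apply]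
    change _ = _ * eval (coord (h v)) F
    rw [← hF, ← mul_assoc, ← mul_pow, h1, one_pow, one_mul]
  rw [e]
  refine mul_mem (pow_mem (prod_mem fun k _ => (hh k).2.2) N) (eval_mem_regular ?_ F)
  rintro (k | k)
  · exact (hh k).1
  · exact (hh k).2.1

theorem isRegularMap_const [Fintype ι] (c : κ → G K) : IsRegularMap fun _ : ι → G K => c :=
  fun _ => ⟨const_mem_regular _, const_mem_regular _, const_mem_regular _⟩

theorem isRegularMap_id [Fintype ι] : IsRegularMap fun v : ι → G K => v :=
  fun j => ⟨add_mem_regular j, mul_mem_regular j, inv_mem_regular j⟩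

theorem IsRegularMap.add [Fintype ι] {g h : (ι → G K) → κ → G K} (hg : IsRegularMap g)
    (hh : IsRegularMap h) : IsRegularMap fun v => g v + h v := by
  refine fun k => ⟨add_mem (hg k).1 (hh k).1, ?_, ?_⟩
  · simpa [Pi.mul_def] using mul_mem (hg k).2.1 (hh k).2.1
  · have := mul_mem (hg k).2.2 (hh k).2.2
    simpa [Pi.mul_def, mul_comm] using this

theorem isRegularMap_matAct [Fintype ι] (M : Matrix κ ι ℤ) :
    IsRegularMap (matAct M : (ι → G K) → κ → G K) := by
  have key : ∀ c : ι → ℤ, (fun v : ι → G K => ((∏ j, (v j).mul ^ c j : Kˣ) : K)) ∈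
      regular K ι := by
    intro c
    have e : (fun v : ι → G K => ((∏ j, (v j).mul ^ c j : Kˣ) : K)) =
        ∏ j, fun v : ι → G K => (((v j).mul ^ c j : Kˣ) : K) := by
      funext v
      rw [Finset.prod_apply, Units.coe_prod]
    rw [e]
    exact prod_mem fun j _ => zpow_mem_regular j _
  refine fun k => ⟨?_, ?_, ?_⟩
  · have e : (fun v : ι → G K => (matAct M v k).add) =
        ∑ j, (fun _ => (M k j : K)) * fun v : ι → G K => (v j).add := by
      funext v
      rw [matAct_add, Finset.sum_apply]
      rfl
    rw [e]
    exact sum_mem fun j _ => mul_mem (const_mem_regular _) (add_mem_regular j)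
  · simp only [matAct_mul]
    exact key _
  · simp only [matAct_mul, ← Finset.prod_inv_distrib, ← zpow_neg]
    exact key fun j => -M k j

theorem isRegularMap_sumElim {κ' : Type} [Fintype ι] {g : (ι → G K) → κ → G K}
    {h : (ι → G K) → κ' → G K} (hg : IsRegularMap g) (hh : IsRegularMap h) :
    IsRegularMap fun v => Sum.elim (g v) (h v) := by
  rintro (k | k)
  · exact hg k
  · exact hh k

/-! ### Irreducible sets -/

/-- The regular functions restricted to `S` form an integral domain. -/
def IsIrred [Fintype ι] (S : Set (ι → G K)) : Prop :=
  S.Nonempty ∧ ∀ φ ∈ regular K ι, ∀ ψ ∈ regular K ι, (∀ s ∈ S, φ s * ψ s = 0) →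
    (∀ s ∈ S, φ s = 0) ∨ ∀ s ∈ S, ψ s = 0

theorem IsIrred.image [Fintype ι] [Fintype κ] {S : Set (ι → G K)} (hS : IsIrred S)
    {h : (ι → G K) → κ → G K} (hh : IsRegularMap h) : IsIrred (h '' S) := by
  refine ⟨hS.1.image h, fun φ hφ ψ hψ H => ?_⟩
  simp only [Set.forall_mem_image] at H ⊢
  exact hS.2 _ (hh.comp_mem hφ) _ (hh.comp_mem hψ) H

theorem isIrred_of_poly [Fintype ι] {S : Set (ι → G K)} (hS : S.Nonempty)
    (H : ∀ F F' : MvPolynomial (ι ⊕ ι) K, (∀ s ∈ S, eval (coord s) (F * F') = 0) →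
      (∀ s ∈ S, eval (coord s) F = 0) ∨ ∀ s ∈ S, eval (coord s) F' = 0) : IsIrred S := by
  refine ⟨hS, ?_⟩
  rintro φ ⟨N, F, hF⟩ ψ ⟨N', F', hF'⟩ h
  have h0 : ∀ (s : ι → G K) (N : ℕ) (a : K), mulProd s ^ N * a = 0 → a = 0 := fun s N a h =>
    (mul_eq_zero.1 h).resolve_left (pow_ne_zero _ (mulProd_ne_zero s))
  refine (H F F' fun s hs => ?_).imp (fun H s hs => h0 s N _ ?_) (fun H s hs => h0 s N' _ ?_)
  · rw [map_mul, ← hF, ← hF', mul_mul_mul_comm, h s hs, mul_zero]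
  · rw [hF, H s hs]
  · rw [hF', H s hs]

theorem isClosed_zeros (F : MvPolynomial (ι ⊕ ι) K) :
    IsClosed {v : ι → G K | eval (coord v) F = 0} := by
  rw [isClosed_iff]
  refine ⟨Ideal.span {F}, ?_⟩
  ext v
  rw [zeroLocus_span]
  simp [aeval_eq_eval]

theorem isIrred_of_isIrreducible [Fintype ι] {S : Set (ι → G K)} (hS : IsIrreducible S) :
    IsIrred S := by
  refine isIrred_of_poly hS.1 fun F F' h => ?_
  refine isPreirreducible_iff_isClosed_union_isClosed.1 hS.2 _ _ (isClosed_zeros F)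
    (isClosed_zeros F') fun s hs => ?_
  have := h s hs
  rwa [map_mul, mul_eq_zero] at this

theorem IsIrred.isIrreducible [Fintype ι] {S : Set (ι → G K)} (hS : IsIrred S) :
    IsIrreducible S := by
  refine ⟨hS.1, isPreirreducible_iff_isClosed_union_isClosed.2 fun Z Z' hZ hZ' hs => ?_⟩
  obtain ⟨I, rfl⟩ := (isClosed_iff Z).1 hZ
  obtain ⟨J, rfl⟩ := (isClosed_iff Z').1 hZ'
  by_contra! hc
  obtain ⟨⟨a, ha, ha'⟩, b, hb, hb'⟩ := And.imp Set.not_subset.1 Set.not_subset.1 hc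
  simp only [Set.mem_preimage, mem_zeroLocus_iff, not_forall] at ha' hb'
  obtain ⟨F, hF, ha'⟩ := ha'
  obtain ⟨F', hF', hb'⟩ := hb'
  have key : ∀ s ∈ S, eval (coord s) F * eval (coord s) F' = 0 := fun s hs' =>
    mul_eq_zero.2 ((hs hs').imp (fun h => h F hF) fun h => h F' hF')
  rcases hS.2 _ (poly_mem_regular F) _ (poly_mem_regular F') key with h | h
  · exact ha' (h a ha)
  · exact hb' (h b hb)

/-! ### Independent functions and dimension -/

/-- No non-zero polynomial relation between the functions `f t` holds on `S`. -/
def IndepOn {X τ : Type*} (S : Set X) (f : τ → X → K) : Prop :=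
  ∀ F : MvPolynomial τ K, (∀ s ∈ S, eval (fun t => f t s) F = 0) → F = 0

theorem IndepOn.mono {X τ : Type*} {S S' : Set X} {f : τ → X → K} (h : IndepOn S f)
    (hS : S ⊆ S') : IndepOn S' f := fun F hF => h F fun s hs => hF s (hS hs)

theorem mem_vanishingIdeal_coord {S : Set (ι → G K)} {F : MvPolynomial (ι ⊕ ι) K} :
    F ∈ vanishingIdeal K (coord '' S) ↔ ∀ s ∈ S, eval (coord s) F = 0 := by
  rw [mem_vanishingIdeal_iff]
  simp [aeval_eq_eval]

theorem IsIrred.isPrime [Fintype ι] {S : Set (ι → G K)} (hS : IsIrred S) :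
    (vanishingIdeal K (coord '' S)).IsPrime := by
  refine ⟨?_, fun {F F'} h => ?_⟩
  · obtain ⟨s, hs⟩ := hS.1
    rw [Ideal.ne_top_iff_one, mem_vanishingIdeal_coord]
    intro h
    simpa using h s hs
  · simp only [mem_vanishingIdeal_coord] at h ⊢
    exact hS.2 _ (poly_mem_regular F) _ (poly_mem_regular F') (by simpa using h)

/-- The regular functions on a subset of `𝔾^ι`. -/
def regularOn [Fintype ι] (S : Set (ι → G K)) : Subalgebra K (S → K) :=
  (regular K ι).map (AlgHom.pi fun s : S => Pi.evalAlgHom K (fun _ => K) s.1)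

theorem mem_regularOn [Fintype ι] {S : Set (ι → G K)} {f : S → K} :
    f ∈ regularOn S ↔ ∃ φ ∈ regular K ι, ∀ s : S, φ s = f s := by
  rw [regularOn, Subalgebra.mem_map]
  refine exists_congr fun φ => and_congr_right fun _ => ?_
  rw [funext_iff]
  rfl

theorem IsIrred.noZeroDivisors [Fintype ι] {S : Set (ι → G K)} (hS : IsIrred S) :
    NoZeroDivisors (regularOn S) := by
  refine ⟨fun {a b} h => ?_⟩
  obtain ⟨φ, hφ, ha⟩ := mem_regularOn.1 a.2
  obtain ⟨ψ, hψ, hb⟩ := mem_regularOn.1 b.2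
  refine (hS.2 φ hφ ψ hψ fun s hs => ?_).imp (fun h' => ?_) fun h' => ?_
  · rw [ha ⟨s, hs⟩, hb ⟨s, hs⟩]
    exact congrFun (congrArg Subtype.val h) ⟨s, hs⟩
  · ext s
    rw [← ha s]
    exact h' s s.2
  · ext s
    rw [← hb s]
    exact h' s s.2

theorem exists_algHom_regularOn [Fintype ι] (S : Set (ι → G K)) :
    ∃ g : MvPolynomial (ι ⊕ ι) K ⧸ vanishingIdeal K (coord '' S) →ₐ[K] regularOn S,
      ∀ F (s : S), (g (Ideal.Quotient.mk _ F)).1 s = eval (coord s.1) F := by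
  let g₀ : MvPolynomial (ι ⊕ ι) K →ₐ[K] regularOn S :=
    aeval fun t => ⟨fun s : S => coord s.1 t, mem_regularOn.2 ⟨_,
        coord_mem_regular t, fun _ => rfl⟩⟩
  have hg₀ : ∀ F (s : S), (g₀ F).1 s = eval (coord s.1) F := by
    intro F s
    induction F using MvPolynomial.induction_on with
    | C a => simp [g₀]
    | add p q hp hq => simp [hp, hq]
    | mul_X p t hp => simp [hp]; left; simp [g₀]
  refine ⟨Ideal.Quotient.liftₐ _ g₀ fun F hF => ?_, fun F s => ?_⟩
  · ext s
    rw [hg₀]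
    exact mem_vanishingIdeal_coord.1 hF s s.2
  · exact hg₀ F s

/-- A regular function satisfies a degree-one equation over the polynomial functions, with leading
coefficient a power of the product of the multiplicative coordinates. Inverting that product
therefore does not change the transcendence degree. -/
theorem trdeg_regularOn [Fintype ι] {S : Set (ι → G K)} (hS : IsIrred S) :
    Algebra.trdeg K (regularOn S) = dim S := by
  obtain ⟨g, hg⟩ := exists_algHom_regularOn S
  have := hS.isPrime
  have := hS.noZeroDivisors
  have : Nontrivial (S → K) := by
    have := hS.1.to_subtype
    infer_instance
  have hinj : Function.Injective g := by
    rw [injective_iff_map_eq_zero]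
    intro a ha
    obtain ⟨F, rfl⟩ := Ideal.Quotient.mk_surjective a
    rw [Ideal.Quotient.eq_zero_iff_mem, mem_vanishingIdeal_coord]
    intro s hs
    rw [← hg F ⟨s, hs⟩, ha]
    rfl
  let _ := g.toRingHom.toAlgebra
  have : IsScalarTower K (MvPolynomial (ι ⊕ ι) K ⧸ vanishingIdeal K (coord '' S)) (regularOn S) :=
    IsScalarTower.of_algebraMap_eq' g.comp_algebraMap.symm
  have : FaithfulSMul (MvPolynomial (ι ⊕ ι) K ⧸ vanishingIdeal K (coord '' S)) (regularOn S) :=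
    (faithfulSMul_iff_algebraMap_injective _ _).2 hinj
  have halg : Algebra.IsAlgebraic (MvPolynomial (ι ⊕ ι) K ⧸ vanishingIdeal K (coord '' S))
      (regularOn S) := by
    refine ⟨fun a => ?_⟩
    obtain ⟨φ, ⟨N, F, hF⟩, ha⟩ := mem_regularOn.1 a.2
    refine ⟨Polynomial.C (Ideal.Quotient.mk _ (mulProdPoly K ι ^ N)) * Polynomial.X -
      Polynomial.C (Ideal.Quotient.mk _ F), fun h => ?_, ?_⟩
    · have h1 := congrArg (Polynomial.coeff · 1) h
      simp only [Polynomial.coeff_sub, Polynomial.coeff_C_mul, Polynomial.coeff_X_one, mul_one,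
        Polynomial.coeff_C_succ, sub_zero, Polynomial.coeff_zero] at h1
      rw [Ideal.Quotient.eq_zero_iff_mem, mem_vanishingIdeal_coord] at h1
      obtain ⟨s, hs⟩ := hS.1
      have := h1 s hs
      rw [map_pow, eval_mulProdPoly] at this
      exact pow_ne_zero _ (mulProd_ne_zero s) this
    · ext s
      rw [map_sub, map_mul, Polynomial.aeval_C, Polynomial.aeval_C, Polynomial.aeval_X]
      change (g _).1 s * a.1 s - (g _).1 s = 0
      rw [hg, hg, ← ha, map_pow, eval_mulProdPoly, hF, sub_self]
  have h0 : Algebra.trdeg (MvPolynomial (ι ⊕ ι) K ⧸ vanishingIdeal K (coord '' S))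
      (regularOn S) = 0 := trdeg_eq_zero
  rw [← trdeg_add_eq K (MvPolynomial (ι ⊕ ι) K ⧸ vanishingIdeal K (coord '' S))
    (A := regularOn S), h0, add_zero, dim, affDim_eq]

/-- Together with `IsIrred.exists_indepOn_coord` this replaces transcendence degrees by explicit
independent functions in all later dimension estimates. -/
theorem IsIrred.card_le_dim [Fintype ι] {S : Set (ι → G K)} (hS : IsIrred S) {τ : Type}
    [Fintype τ] {f : τ → (ι → G K) → K} (hf : ∀ t, f t ∈ regular K ι) (h : IndepOn S f) :
    Fintype.card τ ≤ dim S := by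
  let x : τ → regularOn S := fun t => ⟨fun s => f t s, mem_regularOn.2 ⟨_, hf t, fun _ => rfl⟩⟩
  have : Nontrivial (S → K) := by
    have := hS.1.to_subtype
    infer_instance
  have hx : AlgebraicIndependent K x := by
    rw [← AlgHom.algebraicIndependent_iff (regularOn S).val Subtype.val_injective,
      algebraicIndependent_iff]
    intro F hF
    refine h F fun s hs => ?_
    have := congrFun hF ⟨s, hs⟩
    rwa [aeval_pi_apply] at this
  have := hx.lift_cardinalMk_le_trdeg
  rw [trdeg_regularOn hS, Cardinal.lift_natCast, Cardinal.mk_fintype, Cardinal.lift_natCast,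
    Nat.cast_le] at this
  exact this

/-- A generating family of an algebra contains a transcendence basis. -/
theorem exists_algebraicIndependent_of_surjective {τ A : Type*} [Finite τ] [CommRing A] [IsDomain A]
    [Algebra K A] {x : τ → A} (hx : Function.Surjective (aeval x : MvPolynomial τ K →ₐ[K] A)) :
    ∃ e : Fin (Cardinal.toNat (Algebra.trdeg K A)) → τ,
        AlgebraicIndependent K fun i => x (e i) := by
  have hx' : Algebra.adjoin K (Set.range x) = ⊤ := by
    rw [Algebra.adjoin_range_eq_range_aeval]
    exact (AlgHom.range_eq_top _).2 hx
  have : Algebra.IsAlgebraic (Algebra.adjoin K (Set.range x)) A := by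
    refine ⟨fun a => ?_⟩
    exact isAlgebraic_algebraMap (R := Algebra.adjoin K (Set.range x)) ⟨a, hx' ▸ trivial⟩
  obtain ⟨t, ht, hb⟩ := exists_isTranscendenceBasis_subset (R := K) (Set.range x)
  have hfin : Finite t := (Set.finite_range x).subset ht
  have hn : Nat.card t = Cardinal.toNat (Algebra.trdeg K A) := by
    rw [← hb.cardinalMk_eq_trdeg, Nat.card]
  let q : Fin (Cardinal.toNat (Algebra.trdeg K A)) ≃ t :=
    (finCongr hn.symm).trans (Finite.equivFin t).symm
  choose e he using fun i => ht (q i).2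
  refine ⟨e, ?_⟩
  simp only [he]
  exact hb.1.comp q q.injective

theorem IsIrred.exists_indepOn_coord [Fintype ι] {S : Set (ι → G K)} (hS : IsIrred S) :
    ∃ e : Fin (dim S) → ι ⊕ ι, IndepOn S fun i v => coord v (e i) := by
  have := hS.isPrime
  have hx : (aeval fun t => Ideal.Quotient.mk (vanishingIdeal K (coord '' S)) (X t)) =
      Ideal.Quotient.mkₐ K (vanishingIdeal K (coord '' S)) := by
    ext t
    simp
  obtain ⟨e, he⟩ : ∃ e : Fin (dim S) → ι ⊕ ι, AlgebraicIndependent K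
      fun i => Ideal.Quotient.mk (vanishingIdeal K (coord '' S)) (X (e i)) :=
    exists_algebraicIndependent_of_surjective
      (x := fun t => Ideal.Quotient.mk (vanishingIdeal K (coord '' S)) (X t))
      (by rw [hx]; exact Ideal.Quotient.mkₐ_surjective _ _)
  refine ⟨e, fun F hF => he.eq_zero_of_aeval_eq_zero F ?_⟩
  have h1 := congrArg (fun g => g (rename e F)) hx
  simp only [aeval_rename] at h1
  refine h1.trans ?_
  rw [Ideal.Quotient.mkₐ_eq_mk, Ideal.Quotient.eq_zero_iff_mem, mem_vanishingIdeal_coord]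
  intro s hs
  rw [eval_rename]
  exact hF s hs

theorem IsIrred.dim_image_le [Fintype ι] [Fintype κ] {S : Set (ι → G K)} (hS : IsIrred S)
    {h : (ι → G K) → κ → G K} (hh : IsRegularMap h) : dim (h '' S) ≤ dim S := by
  obtain ⟨e, he⟩ := (hS.image hh).exists_indepOn_coord
  have := hS.card_le_dim (f := fun i v => coord (h v) (e i))
    (fun i => hh.comp_mem (coord_mem_regular (e i)))
    fun F hF => he F fun s hs => by
      obtain ⟨v, hv, rfl⟩ := hs
      exact hF v hv
  simpa using this

theorem IsIrred.exists_forall_eq_zero_of_prod [Fintype ι] {S : Set (ι → G K)} (hS : IsIrred S)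
    {τ : Type*} (t : Finset τ) {φ : τ → (ι → G K) → K} (hφ : ∀ i ∈ t, φ i ∈ regular K ι)
    (h : ∀ s ∈ S, ∏ i ∈ t, φ i s = 0) : ∃ i ∈ t, ∀ s ∈ S, φ i s = 0 := by
  classical
  induction t using Finset.induction_on with
  | empty =>
    obtain ⟨s, hs⟩ := hS.1
    simpa using h s hs
  | insert a t ha ih =>
    simp only [Finset.prod_insert ha] at h
    have hprod : (fun s => ∏ i ∈ t, φ i s) ∈ regular K ι := by
      have e : (fun s => ∏ i ∈ t, φ i s) = ∏ i ∈ t, φ i := by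
        funext s
        rw [Finset.prod_apply]
      rw [e]
      exact prod_mem fun i hi => hφ i (Finset.mem_insert_of_mem hi)
    rcases hS.2 _ (hφ a (Finset.mem_insert_self a t)) _ hprod h with h | h
    · exact ⟨a, Finset.mem_insert_self a t, h⟩
    · obtain ⟨i, hi, h⟩ := ih (fun i hi => hφ i (Finset.mem_insert_of_mem hi)) h
      exact ⟨i, Finset.mem_insert_of_mem hi, h⟩

theorem indepOn_iff_algebraicIndependent {X τ : Type*} {S : Set X} {f : τ → X → K} :
    IndepOn S f ↔ AlgebraicIndependent K fun t (s : S) => f t s := by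
  rw [algebraicIndependent_iff]
  refine forall_congr' fun F => imp_congr_left ?_
  rw [funext_iff]
  simp [aeval_pi_apply]

theorem indepOn_unique_iff {X τ : Type*} [Unique τ] {S : Set X} {f : X → K} :
    IndepOn S (fun _ : τ => f) ↔ ∀ p : Polynomial K, (∀ s ∈ S, p.eval (f s) = 0) → p = 0 := by
  rw [indepOn_iff_algebraicIndependent, algebraicIndependent_unique_type_iff, transcendental_iff]
  refine forall_congr' fun p => imp_congr_left ?_
  have : ∀ s : S, (Polynomial.aeval (fun s : S => f s) p) s = p.eval (f s) := by
    intro s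
    induction p using Polynomial.induction_on' with
    | add p q hp hq => simp_all
    | monomial n a => simp
  rw [funext_iff]
  simp [this]

/-- If a non-zero polynomial kills `φ`, the product of `φ - c` over its finitely many roots vanishes
on `S`, and irreducibility makes one factor vanish identically. -/
theorem IsIrred.indepOn_of_not_const [Fintype ι] {S : Set (ι → G K)} (hS : IsIrred S)
    {φ : (ι → G K) → K} (hφ : φ ∈ regular K ι) (h : ¬∃ c, ∀ s ∈ S, φ s = c) {τ : Type*}
    [Unique τ] : IndepOn S fun _ : τ => φ := by
  classical
  rw [indepOn_unique_iff]
  intro p hp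
  by_contra hp0
  obtain ⟨c, -, hc⟩ := hS.exists_forall_eq_zero_of_prod p.roots.toFinset (φ := fun c s => φ s - c)
    (fun c _ => sub_mem hφ (const_mem_regular c)) fun s hs =>
      Finset.prod_eq_zero (i := φ s) (by simpa [hp0] using hp s hs) (sub_self _)
  exact h ⟨c, fun s hs => sub_eq_zero.1 (hc s hs)⟩

/-- Induction on the degree in `φ` of a relation: on `S'` only the constant coefficient survives, so
it is zero by independence of `f`; then `φ` can be cancelled because `S` is irreducible and `φ` is
not identically zero on it. -/
theorem IsIrred.indepOn_option [Fintype ι] {S S' : Set (ι → G K)} (hS : IsIrred S)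
    (hSS : S' ⊆ S) {τ : Type} {f : τ → (ι → G K) → K} (hf : ∀ t, f t ∈ regular K ι)
    (hind : IndepOn S' f) {φ : (ι → G K) → K} (hφ : φ ∈ regular K ι)
    (h : ∀ s ∈ S', φ s = 0) (hne : ¬∀ s ∈ S, φ s = 0) :
    IndepOn S fun (t : Option τ) s => t.elim (φ s) fun t => f t s := by
  have hreg : ∀ P : Polynomial (MvPolynomial τ K),
      (fun s => (P.map (eval fun t => f t s)).eval (φ s)) ∈ regular K ι := by
    intro P
    have := eval_mem_regular (f := fun (t : Option τ) s => t.elim (φ s) fun t => f t s)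
      (by rintro (_ | t); exacts [hφ, hf t]) ((optionEquivLeft K τ).symm P)
    simpa only [optionEquivLeft_elim_eval, AlgEquiv.apply_symm_apply] using this
  have key : ∀ (n : ℕ) (P : Polynomial (MvPolynomial τ K)), P.natDegree ≤ n →
      (∀ s ∈ S, (P.map (eval fun t => f t s)).eval (φ s) = 0) → P = 0 := by
    intro n
    induction n with
    | zero =>
      intro P hP h0
      rw [Polynomial.eq_C_of_natDegree_le_zero hP] at h0 ⊢
      rw [hind (P.coeff 0) fun s hs => by simpa using h0 s (hSS hs), Polynomial.C_0]
    | succ n ih =>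
      intro P hP h0
      have hc : P.coeff 0 = 0 := hind _ fun s hs => by
        have := h0 s (hSS hs)
        rw [h s hs, ← Polynomial.coeff_zero_eq_eval_zero, Polynomial.coeff_map] at this
        exact this
      have hd : P.divX = 0 := by
        refine ih _ (by rw [Polynomial.natDegree_divX_eq_natDegree_tsub_one]; omega) ?_
        refine (hS.2 _ hφ _ (hreg _) fun s hs => ?_).resolve_left hne
        have := h0 s hs
        rw [← Polynomial.divX_mul_X_add P, hc] at this
        simpa [mul_comm] using this
      rw [← Polynomial.divX_mul_X_add P, hc, hd]
      simp
  intro F hF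
  have := key _ (optionEquivLeft K τ F) le_rfl fun s hs => by
    rw [← optionEquivLeft_elim_eval]
    exact hF s hs
  simpa using this

/-- A subset of `S` carrying at least `dim S` independent functions is dense in `S`. -/
theorem IsIrred.eq_zero_of_indepOn [Fintype ι] {S S' : Set (ι → G K)} (hS : IsIrred S)
    (hSS : S' ⊆ S) {τ : Type} [Fintype τ] {f : τ → (ι → G K) → K}
    (hf : ∀ t, f t ∈ regular K ι) (hind : IndepOn S' f) (hcard : dim S ≤ Fintype.card τ)
    {φ : (ι → G K) → K} (hφ : φ ∈ regular K ι) (h : ∀ s ∈ S', φ s = 0) : ∀ s ∈ S, φ s = 0 := by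
  by_contra hne
  have := hS.card_le_dim (by rintro (_ | t); exacts [hφ, hf t])
    (hS.indepOn_option hSS hf hind hφ h hne)
  rw [Fintype.card_option] at this
  omega

theorem eval_sumAlgEquiv {σ τ : Type*} (F : MvPolynomial (σ ⊕ τ) K) (a : σ → K) (b : τ → K) :
    eval a (map (eval b) (sumAlgEquiv K σ τ F)) = eval (Sum.elim a b) F := by
  induction F using MvPolynomial.induction_on with
  | C a => simp
  | add p q hp hq => simp [hp, hq]
  | mul_X p t hp => cases t <;> simp [hp]

/-- The substitution `X i ↦ a i * X i + b i` is invertible on polynomials. -/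
theorem eq_zero_of_eval_affine {Ω σ : Type*} {S : Set Ω} {f : σ → Ω → K} (hf : IndepOn S f)
    {a b : σ → K} (ha : ∀ i, a i ≠ 0) {F : MvPolynomial σ K}
    (h : ∀ s ∈ S, eval (fun i => a i * f i s + b i) F = 0) : F = 0 := by
  have h1 : aeval (fun i => C (a i) * X i + C (b i) : σ → MvPolynomial σ K) F = 0 := by
    refine hf _ fun s hs => ?_
    rw [← h s hs]
    clear h
    induction F using MvPolynomial.induction_on with
    | C a => simp
    | add p q hp hq => simp only [map_add, hp, hq]
    | mul_X p t hp => simp only [map_mul, hp, aeval_X, map_add, eval_C, eval_X]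
  have h2 := congrArg (aeval (fun i => C (a i)⁻¹ * (X i - C (b i)) : σ → MvPolynomial σ K)) h1
  rw [MvPolynomial.comp_aeval_apply, map_zero] at h2
  rw [← h2]
  have : (fun i => aeval (fun i => C (a i)⁻¹ * (X i - C (b i)) : σ → MvPolynomial σ K)
      (C (a i) * X i + C (b i))) = X := by
    funext i
    simp only [map_add, map_mul, aeval_X, algHom_C, algebraMap_eq]
    rw [← mul_assoc, ← C_mul, mul_inv_cancel₀ (ha i), C_1]
    ring
  rw [this, aeval_X_left_apply]

/-- Translating independent functions on one factor of a product by functions on the other factor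
preserves joint independence. -/
theorem IndepOn.prod {X Y σ τ : Type*} {S : Set X} {T : Set Y} {f : σ → X → K} {g : τ → Y → K}
    (hf : IndepOn S f) (hg : IndepOn T g) {a b : σ → Y → K} (ha : ∀ i y, a i y ≠ 0) :
    IndepOn (S ×ˢ T) fun (t : σ ⊕ τ) (p : X × Y) =>
      Sum.elim (fun i => a i p.2 * f i p.1 + b i p.2) (fun j => g j p.2) t := by
  intro F hF
  by_contra hne
  have h1 : sumAlgEquiv K σ τ F ≠ 0 := by simpa using hne
  -- Some coefficient of `F`, seen as a polynomial over the second block of variables, is non-zero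
  -- at a point `y` of `T`; on the slice at `y` independence of `f` contradicts this.
  obtain ⟨m, hm⟩ := MvPolynomial.ne_zero_iff.1 h1
  obtain ⟨y, hy, hm⟩ : ∃ y ∈ T, eval (fun j => g j y) (coeff m (sumAlgEquiv K σ τ F)) ≠ 0 := by
    by_contra! hc
    exact hm (hg _ hc)
  apply hm
  have h2 : map (eval fun j => g j y) (sumAlgEquiv K σ τ F) = 0 := by
    refine eq_zero_of_eval_affine hf (a := fun i => a i y) (b := fun i => b i y)
      (fun i => ha i y) fun x hx => ?_
    rw [eval_sumAlgEquiv, ← hF (x, y) ⟨hx, hy⟩]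
  rw [← coeff_map, h2, coeff_zero]

theorem IsIrred.image2_sumElim [Fintype ι] [Fintype κ] {S : Set (ι → G K)} {T : Set (κ → G K)}
    (hS : IsIrred S) (hT : IsIrred T) : IsIrred (Set.image2 Sum.elim S T) := by
  refine ⟨hS.1.image2 hT.1, fun φ hφ ψ hψ h => ?_⟩
  rw [Set.forall_mem_image2] at *
  rw [Set.forall_mem_image2]
  by_contra! hc
  obtain ⟨⟨x, hx, y, hy, h1⟩, x', hx', y', hy', h2⟩ := hc
  have hl : ∀ y : κ → G K, IsRegularMap fun x : ι → G K => Sum.elim x y := fun y =>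
    isRegularMap_sumElim isRegularMap_id (isRegularMap_const y)
  have hr : ∀ x : ι → G K, IsRegularMap fun y : κ → G K => Sum.elim x y := fun x =>
    isRegularMap_sumElim (isRegularMap_const x) isRegularMap_id
  -- Irreducibility of `T` gives one slice on which neither function vanishes identically;
  -- irreducibility of `S` applies to that slice.
  obtain ⟨z, hz, h3⟩ : ∃ z ∈ T, φ (Sum.elim x z) * ψ (Sum.elim x' z) ≠ 0 := by
    by_contra! hc
    rcases hT.2 _ ((hr x).comp_mem hφ) _ ((hr x').comp_mem hψ) hc with h | h
    · exact h1 (h y hy)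
    · exact h2 (h y' hy')
  rcases hS.2 _ ((hl z).comp_mem hφ) _ ((hl z).comp_mem hψ) (fun s hs => h s hs z hz) with h | h
  · exact left_ne_zero_of_mul h3 (h x hx)
  · exact right_ne_zero_of_mul h3 (h x' hx')

/-! ### Points of integral extensions -/

/-- Finite maps are surjective on points: lie over the maximal ideal of `t`, then apply the
Nullstellensatz to get a point. -/
theorem exists_mem_zeroLocus_of_isIntegral [IsAlgClosed K] {α τ : Type} [Finite τ]
    (g : MvPolynomial α K →ₐ[K] MvPolynomial τ K) (Q : Ideal (MvPolynomial τ K))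
    (hg : ((Ideal.Quotient.mk Q).comp g.toRingHom).IsIntegral) (t : α → K)
    (ht : ∀ F, g F ∈ Q → eval t F = 0) :
    ∃ x ∈ zeroLocus K Q, ∀ F, eval x (g F) = eval t F := by
  let _ := ((Ideal.Quotient.mk Q).comp g.toRingHom).toAlgebra
  have : Algebra.IsIntegral (MvPolynomial α K) (MvPolynomial τ K ⧸ Q) := ⟨hg⟩
  have hmax : (RingHom.ker (eval t)).IsMaximal :=
    RingHom.ker_isMaximal_of_surjective _ fun a => ⟨C a, eval_C a⟩
  obtain ⟨M, hM, hMt⟩ := Ideal.exists_ideal_over_maximal_of_isIntegral (S := MvPolynomial τ K ⧸ Q)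
    (RingHom.ker (eval t)) fun F hF =>
        ht F (Ideal.Quotient.eq_zero_iff_mem.1 (RingHom.mem_ker.1 hF))
  have hM' : (M.comap (Ideal.Quotient.mk Q)).IsMaximal :=
    Ideal.comap_isMaximal_of_surjective _ Ideal.Quotient.mk_surjective
  obtain ⟨x, hx⟩ := isMaximal_iff_eq_vanishingIdeal_singleton.1 hM'
  have key : ∀ F, F ∈ M.comap (Ideal.Quotient.mk Q) ↔ eval x F = 0 := by
    intro F
    rw [hx, mem_vanishingIdeal_singleton_iff, aeval_eq_eval]
  refine ⟨x, fun F hF => ?_, fun F => ?_⟩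
  · rw [aeval_eq_eval]
    refine (key F).1 ?_
    rw [Ideal.mem_comap, Ideal.Quotient.eq_zero_iff_mem.2 hF]
    exact M.zero_mem
  · have h1 : F - C (eval t F) ∈
      M.comap (algebraMap (MvPolynomial α K) (MvPolynomial τ K ⧸ Q)) := by
      rw [hMt, RingHom.mem_ker]
      simp
    have h2 := (key (g (F - C (eval t F)))).1 h1
    rw [map_sub, map_sub, sub_eq_zero] at h2
    rw [h2, ← algebraMap_eq, AlgHom.commutes, algebraMap_eq, eval_C]

/-! ### Division by two -/

/-- The comorphism of multiplication by two. -/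
def doubleHom (K : Type u) [Field K] (ι : Type) :
    MvPolynomial (ι ⊕ ι) K →ₐ[K] MvPolynomial (ι ⊕ ι) K :=
  aeval (Sum.elim (fun j => C 2 * X (Sum.inl j)) fun j => X (Sum.inr j) ^ 2)

theorem eval_doubleHom (v : ι → G K) (F : MvPolynomial (ι ⊕ ι) K) :
    eval (coord v) (doubleHom K ι F) = eval (coord (2 • v)) F := by
  induction F using MvPolynomial.induction_on with
  | C a => simp
  | add p q hp hq => simp [hp, hq]
  | mul_X p t hp =>
    rw [map_mul, map_mul, map_mul, hp, doubleHom, aeval_X, eval_X]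
    cases t <;> simp

theorem doubleHom_isIntegral [CharZero K] : (doubleHom K ι).toRingHom.IsIntegral := by
  intro F
  induction F using MvPolynomial.induction_on with
  | C a =>
    have : (doubleHom K ι).toRingHom (C a) = C a := by simp
    rw [← this]
    exact RingHom.isIntegralElem_map _
  | add p q hp hq => exact hp.add _ hq
  | mul_X p t hp =>
    refine hp.mul _ ?_
    rcases t with j | j
    · have : (doubleHom K ι).toRingHom (C (2⁻¹) * X (Sum.inl j)) = X (Sum.inl j) := by
        simp only [doubleHom, AlgHom.toRingHom_eq_coe, RingHom.coe_coe, map_mul, algHom_C,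
          algebraMap_eq, aeval_X, Sum.elim_inl]
        rw [← mul_assoc, ← C_mul, inv_mul_cancel₀ two_ne_zero, C_1, one_mul]
      rw [← this]
      exact RingHom.isIntegralElem_map _
    · refine ⟨Polynomial.X ^ 2 - Polynomial.C (X (Sum.inr j)),
        Polynomial.monic_X_pow_sub_C _ two_ne_zero, ?_⟩
      simp [doubleHom]

theorem exists_isPrime_comap_eq_of_isIntegral {A B : Type*} [CommRing A] [CommRing B] {f : A →+* B}
    (hf : f.IsIntegral) (P : Ideal A) [P.IsPrime] (h : RingHom.ker f ≤ P) :
    ∃ Q : Ideal B, Q.IsPrime ∧ Q.comap f = P := by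
  let _ := f.toAlgebra
  have : Algebra.IsIntegral A B := ⟨hf⟩
  obtain ⟨Q, -, hQ⟩ := Ideal.exists_ideal_over_prime_of_isIntegral (S := B) P ⊥ h
  exact ⟨Q, hQ⟩

theorem exists_two_nsmul_eq [IsAlgClosed K] [CharZero K] (v : ι → G K) :
    ∃ x : ι → G K, 2 • x = v := by
  have : ∀ j, ∃ g : G K, 2 • g = v j := by
    intro j
    obtain ⟨u, hu⟩ := IsAlgClosed.exists_pow_nat_eq ((v j).mul : K) (n := 2) (by norm_num)
    have hu0 : u ≠ 0 := by
      rintro rfl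
      exact (v j).mul.ne_zero (by rw [← hu]; ring)
    refine ⟨G.mk ((v j).add / 2) (Units.mk0 u hu0), G.ext ?_ (Units.ext ?_)⟩
    · rw [G.add_nsmul, G.add_mk]
      push_cast
      ring
    · rw [G.mul_nsmul, G.mul_mk, Units.val_pow_eq_pow_val, Units.val_mk0, hu]
  choose x hx using this
  exact ⟨x, funext hx⟩

theorem exists_coord_eq {x : ι ⊕ ι → K} (hx : ∀ j, x (Sum.inr j) ≠ 0) :
    ∃ v : ι → G K, coord v = x := by
  refine ⟨fun j => G.mk (x (Sum.inl j)) (Units.mk0 _ (hx j)), funext fun t => ?_⟩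
  cases t <;> rfl

/-- Passes from the principal open set `𝔾^ι` to affine space: a point outside it has a zero
multiplicative coordinate, which kills the extra factor. -/
theorem eval_mulProdPoly_mul_eq_zero [Fintype ι] {Q : Ideal (MvPolynomial (ι ⊕ ι) K)}
    {τ : Type*} {f : (ι ⊕ ι → K) → τ → K} {F : MvPolynomial τ K}
    (h : ∀ v ∈ coord ⁻¹' zeroLocus K Q, eval (f (coord v)) F = 0) {x : ι ⊕ ι → K}
    (hx : x ∈ zeroLocus K Q) : eval x (mulProdPoly K ι) * eval (f x) F = 0 := by
  by_cases hx0 : ∀ j, x (Sum.inr j) ≠ 0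
  · obtain ⟨v, rfl⟩ := exists_coord_eq hx0
    rw [h v hx, mul_zero]
  · push Not at hx0
    obtain ⟨j, hj⟩ := hx0
    rw [mulProdPoly, map_prod, Finset.prod_eq_zero (Finset.mem_univ j) (by rw [eval_X, hj]),
      zero_mul]

theorem mem_of_forall_coord [IsAlgClosed K] [Fintype ι] {Q : Ideal (MvPolynomial (ι ⊕ ι) K)}
    [Q.IsPrime] (hQ : mulProdPoly K ι ∉ Q) {F : MvPolynomial (ι ⊕ ι) K}
    (h : ∀ v ∈ coord ⁻¹' zeroLocus K Q, eval (coord v) F = 0) : F ∈ Q := by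
  have h1 : mulProdPoly K ι * F ∈ vanishingIdeal K (zeroLocus K Q) := by
    rw [mem_vanishingIdeal_iff]
    intro x hx
    rw [aeval_eq_eval, map_mul]
    exact eval_mulProdPoly_mul_eq_zero (f := id) h hx
  rw [IsPrime.vanishingIdeal_zeroLocus] at h1
  exact (Ideal.IsPrime.mem_or_mem ‹_› h1).resolve_left hQ

/-- The prime `Q` lies over the ideal of `V` along the integral comorphism of doubling, so its locus
is an irreducible set mapping onto `V`. -/
theorem exists_isIrred_double [IsAlgClosed K] [CharZero K] [Fintype ι] {V : Set (ι → G K)}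
    (hV : IsIrred V) (hc : IsClosed V) :
    ∃ Q : Ideal (MvPolynomial (ι ⊕ ι) K), Q.IsPrime ∧ mulProdPoly K ι ∉ Q ∧
      IsIrred (coord ⁻¹' zeroLocus K Q) ∧
      (fun x : ι → G K => 2 • x) '' (coord ⁻¹' zeroLocus K Q) = V := by
  have hP := hV.isPrime
  have hker : RingHom.ker (doubleHom K ι).toRingHom ≤ vanishingIdeal K (coord '' V) := by
    intro F hF
    rw [mem_vanishingIdeal_coord]
    intro v _
    obtain ⟨x, rfl⟩ := exists_two_nsmul_eq v
    have : doubleHom K ι F = 0 := hF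
    rw [← eval_doubleHom, this, map_zero]
  obtain ⟨Q, hQ, hQP⟩ := exists_isPrime_comap_eq_of_isIntegral doubleHom_isIntegral _ hker
  have hmem : ∀ F, doubleHom K ι F ∈ Q ↔ ∀ v ∈ V, eval (coord v) F = 0 := by
    intro F
    rw [← mem_vanishingIdeal_coord, ← hQP]
    rfl
  -- Otherwise some multiplicative coordinate is in `Q`, hence so is its square, and that coordinate
  -- would vanish on `V`.
  have hm : mulProdPoly K ι ∉ Q := by
    intro h
    obtain ⟨j, -, hj⟩ := (hQ.prod_mem_iff).1 h
    have h1 : doubleHom K ι (X (Sum.inr j)) ∈ Q := by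
      simpa [doubleHom] using Q.pow_mem_of_mem hj 2 two_pos
    obtain ⟨v, hv⟩ := hV.1
    simpa using (hmem _).1 h1 v hv
  have himg : (fun x : ι → G K => 2 • x) '' (coord ⁻¹' zeroLocus K Q) = V := by
    ext v
    constructor
    · rintro ⟨x, hx, rfl⟩
      obtain ⟨I, rfl⟩ := (isClosed_iff V).1 hc
      intro F hF
      have := hx (doubleHom K ι F) ((hmem F).2 fun v hv => by
        rw [← coe_aeval_eq_eval]
        exact hv F hF)
      rw [aeval_eq_eval, eval_doubleHom] at this
      rwa [aeval_eq_eval]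
    · intro hv
      obtain ⟨x, hx, hxv⟩ := exists_mem_zeroLocus_of_isIntegral (doubleHom K ι) Q
        (doubleHom_isIntegral.trans _ _
          (RingHom.isIntegral_of_surjective _ Ideal.Quotient.mk_surjective))
        (coord v) fun F hF => (hmem F).1 hF v hv
      have hx0 : ∀ j, x (Sum.inr j) ≠ 0 := by
        intro j hj
        have := hxv (X (Sum.inr j))
        simp only [doubleHom, aeval_X, Sum.elim_inr, map_pow, eval_X, hj, coord_inr] at this
        exact (v j).mul.ne_zero (this.symm.trans (zero_pow two_ne_zero))
      obtain ⟨y, rfl⟩ := exists_coord_eq hx0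
      refine ⟨y, hx, funext fun j => G.ext ?_ (Units.ext ?_)⟩
      · simpa [eval_doubleHom] using hxv (X (Sum.inl j))
      · simpa [eval_doubleHom] using hxv (X (Sum.inr j))
  refine ⟨Q, hQ, hm, isIrred_of_poly ?_ fun F F' h => ?_, himg⟩
  · rw [← Set.image_nonempty, himg]
    exact hV.1
  · have h1 : F * F' ∈ Q := mem_of_forall_coord hm h
    refine (hQ.mem_or_mem h1).imp (fun h2 v hv => ?_) fun h2 v hv => ?_
    · rw [← coe_aeval_eq_eval]
      exact hv F h2
    · rw [← coe_aeval_eq_eval]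
      exact hv F' h2

/-! ### Density of the graph of the involution -/

/-- After the linear change of variables `(a, b) ↦ (a + i b, a - i b)`, points with integral `a`,
`b` lie on the graph of `σ`, and they are Zariski dense. -/
theorem eq_zero_of_eval_diag [IsAlgClosed K] [CharZero K] {σ : K ≃+* K} (hσ : ∀ x, σ (σ x) = x)
    (hne : ∃ x, σ x ≠ x) {τ : Type} [Finite τ] {F : MvPolynomial (τ ⊕ τ) K}
    (h : ∀ t : τ → K, eval (Sum.elim t fun i => σ (t i)) F = 0) : F = 0 := by
  obtain ⟨i, hi⟩ := IsAlgClosed.exists_pow_nat_eq (-1 : K) (n := 2) (by norm_num)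
  have hI := map_I hσ hne hi
  have hi0 : i ≠ 0 := by
    rintro rfl
    norm_num at hi
  let g : τ ⊕ τ → MvPolynomial (τ ⊕ τ) K :=
    Sum.elim (fun j => X (Sum.inl j) + C i * X (Sum.inr j))
      fun j => X (Sum.inl j) - C i * X (Sum.inr j)
  have hg : ∀ c, eval c (aeval g F) = eval (Sum.elim (fun j => c (Sum.inl j) + i * c (Sum.inr j))
      fun j => c (Sum.inl j) - i * c (Sum.inr j)) F := by
    intro c
    clear h
    induction F using MvPolynomial.induction_on with
    | C a => simp
    | add p q hp hq => simp only [map_add, hp, hq]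
    | mul_X p t hp =>
      rw [map_mul, map_mul, map_mul, hp, aeval_X, eval_X]
      cases t <;> simp [g]
  have h1 : aeval g F = 0 := by
    refine funext_set (fun _ => Set.range ((↑) : ℤ → K))
      (fun _ => Set.infinite_range_of_injective Int.cast_injective) fun c hc => ?_
    choose m hm using fun t => hc t trivial
    rw [hg, map_zero, ← h fun j => c (Sum.inl j) + i * c (Sum.inr j)]
    congr 2
    funext t
    rcases t with j | j
    · rfl
    · simp only [Sum.elim_inr]
      rw [← hm, ← hm, map_add, map_mul, map_intCast, map_intCast, hI, neg_mul, sub_eq_add_neg]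
  refine MvPolynomial.funext fun c => ?_
  -- The inverse change of variables, which shows that `F` itself vanishes everywhere.
  have h2 := hg (Sum.elim (fun j => (c (Sum.inl j) + c (Sum.inr j)) / 2)
    fun j => (c (Sum.inl j) - c (Sum.inr j)) / (2 * i))
  rw [h1, map_zero] at h2
  rw [map_zero, h2]
  congr 2
  funext t
  rcases t with j | j <;> simp <;> field_simp <;> ring

/-- The product of `Z` with its conjugate is irreducible, by slicing. A slice in the conjugate
variable becomes polynomial in `y` once `σ.symm` is applied to its coefficients. -/
theorem prod_noZeroDivisors {τ : Type} {σ : K ≃+* K} {Z : Set (τ → K)}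
    (hZ : ∀ F F' : MvPolynomial τ K, (∀ x ∈ Z, eval x F * eval x F' = 0) →
      (∀ x ∈ Z, eval x F = 0) ∨ ∀ x ∈ Z, eval x F' = 0)
    (F F' : MvPolynomial (τ ⊕ τ) K)
    (h : ∀ x ∈ Z, ∀ y ∈ Z, eval (Sum.elim x fun t => σ (y t)) F *
      eval (Sum.elim x fun t => σ (y t)) F' = 0) :
    (∀ x ∈ Z, ∀ y ∈ Z, eval (Sum.elim x fun t => σ (y t)) F = 0) ∨
      ∀ x ∈ Z, ∀ y ∈ Z, eval (Sum.elim x fun t => σ (y t)) F' = 0 := by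
  have hl : ∀ (F : MvPolynomial (τ ⊕ τ) K) (y : τ → K), ∃ P : MvPolynomial τ K, ∀ x,
      eval x P = eval (Sum.elim x fun t => σ (y t)) F := by
    intro F y
    refine ⟨map (eval fun t => σ (y t)) (sumAlgEquiv K τ τ F), fun x => eval_sumAlgEquiv F _ _⟩
  have hr : ∀ (F : MvPolynomial (τ ⊕ τ) K) (x : τ → K), ∃ P : MvPolynomial τ K, ∀ y,
      σ (eval y P) = eval (Sum.elim x fun t => σ (y t)) F := by
    intro F x
    refine ⟨aeval (Sum.elim (fun t => C (σ.symm (x t))) X) (map (σ.symm : K →+* K) F), fun y => ?_⟩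
    induction F using MvPolynomial.induction_on with
    | C a => simp [algebraMap_eq]
    | add p q hp hq => simp only [map_add, hp, hq]
    | mul_X p t hp =>
      simp only [map_mul, hp, map_X, aeval_X, eval_X]
      cases t <;> simp
  by_contra! hc
  obtain ⟨⟨x, hx, y, hy, h1⟩, x', hx', y', hy', h2⟩ := hc
  obtain ⟨P, hP⟩ := hr F x
  obtain ⟨P', hP'⟩ := hr F' x'
  obtain ⟨z, hz, h3, h4⟩ : ∃ z ∈ Z, eval (Sum.elim x fun t => σ (z t)) F ≠ 0 ∧
      eval (Sum.elim x' fun t => σ (z t)) F' ≠ 0 := by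
    by_contra! hc
    have key : ∀ z ∈ Z, eval z P * eval z P' = 0 := by
      intro z hz
      by_cases h0 : eval z P = 0
      · rw [h0, zero_mul]
      · have := hc z hz (by rw [← hP]; simpa using h0)
        rw [← hP', map_eq_zero_iff σ σ.injective] at this
        rw [this, mul_zero]
    rcases hZ P P' key with h | h
    · exact h1 (by rw [← hP, h y hy, map_zero])
    · exact h2 (by rw [← hP', h y' hy', map_zero])
  obtain ⟨P, hP⟩ := hl F z
  obtain ⟨P', hP'⟩ := hl F' z
  rcases hZ P P' fun x hx => by rw [hP, hP', h x hx z hz] with h | h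
  · exact h3 (by rw [← hP, h x hx])
  · exact h4 (by rw [← hP', h x' hx'])

theorem eval_aeval_eq {α τ : Type*} (c : τ → K) (f : α → MvPolynomial τ K) (P : MvPolynomial α K) :
    eval c (aeval f P) = eval (fun i => eval c (f i)) P := by
  induction P using MvPolynomial.induction_on with
  | C a => simp
  | add p q hp hq => simp only [map_add, hp, hq]
  | mul_X p t hp => simp only [map_mul, hp, aeval_X, eval_X]

theorem eval_map_ringEquiv {τ : Type*} (σ : K ≃+* K) (c : τ → K) (P : MvPolynomial τ K) :
    eval (fun t => σ (c t)) (map (σ : K →+* K) P) = σ (eval c P) := by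
  induction P using MvPolynomial.induction_on with
  | C a => simp
  | add p q hp hq => simp only [map_add, hp, hq]
  | mul_X p t hp => simp only [map_mul, hp, map_X, eval_X]

/-- Noether normalisation gives a finite surjective map from `Z` to `K^d`, hence `Z × Z̄` is finite
over `K^(2d)`. A non-zero ideal of functions vanishing on the graph would contract to a non-zero
ideal of polynomials vanishing at all `(t, σ t)`. -/
theorem eval_eq_zero_of_diag [IsAlgClosed K] [CharZero K] {σ : K ≃+* K} (hσ : ∀ x, σ (σ x) = x)
    (hne : ∃ x, σ x ≠ x) {τ : Type} [Finite τ] {Q : Ideal (MvPolynomial τ K)} [hQ : Q.IsPrime]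
    {F : MvPolynomial (τ ⊕ τ) K}
    (h : ∀ x ∈ zeroLocus K Q, eval (Sum.elim x fun t => σ (x t)) F = 0) :
    ∀ x ∈ zeroLocus K Q, ∀ y ∈ zeroLocus K Q, eval (Sum.elim x fun t => σ (y t)) F = 0 := by
  set Z := zeroLocus K Q with hZ
  have hvan : ∀ P : MvPolynomial τ K, P ∈ Q ↔ ∀ x ∈ Z, eval x P = 0 := by
    intro P
    conv_lhs => rw [← IsPrime.vanishingIdeal_zeroLocus (K := K) Q]
    rfl
  have hdom : ∀ F F' : MvPolynomial τ K, (∀ x ∈ Z, eval x F * eval x F' = 0) →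
      (∀ x ∈ Z, eval x F = 0) ∨ ∀ x ∈ Z, eval x F' = 0 := by
    intro F F' h
    rw [← hvan, ← hvan]
    exact hQ.mem_or_mem ((hvan _).2 (by simpa using h))
  -- the ring of functions on `Z × Z` generated by the coordinates and the conjugate coordinates
  let ev : MvPolynomial (τ ⊕ τ) K →+* (Z × Z → K) :=
    RingHom.pi fun p => eval (Sum.elim p.1.1 fun t => σ (p.2.1 t))
  have hev : ∀ P p, ev P p = eval (Sum.elim p.1.1 fun t => σ (p.2.1 t)) P := fun _ _ => rfl
  have hZne : Z.Nonempty := by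
    by_contra hc
    rw [Set.not_nonempty_iff_eq_empty] at hc
    exact hQ.ne_top ((Ideal.eq_top_iff_one _).2 ((hvan 1).2 (by simp [hc])))
  have := hZne.to_subtype
  have hA : IsDomain ev.range := by
    have : NoZeroDivisors ev.range := by
      constructor
      rintro ⟨_, P, rfl⟩ ⟨_, P', rfl⟩ h0
      have h1 := prod_noZeroDivisors hdom P P' (σ := σ) fun x hx y hy =>
        congrFun (congrArg Subtype.val h0) (⟨x, hx⟩, ⟨y, hy⟩)
      refine h1.imp (fun h2 => ?_) fun h2 => ?_
      · ext p
        exact h2 _ p.1.2 _ p.2.2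
      · ext p
        exact h2 _ p.1.2 _ p.2.2
    exact NoZeroDivisors.to_isDomain _
  obtain ⟨d, g, hginj, hgint⟩ := exists_integral_inj_algHom_of_fg K (MvPolynomial τ K ⧸ Q)
  choose p hp using fun i => Ideal.Quotient.mk_surjective (g (X i))
  let G : MvPolynomial (Fin d) K →ₐ[K] MvPolynomial τ K := aeval p
  have hG : ∀ P, Ideal.Quotient.mk Q (G P) = g P := by
    have : (Ideal.Quotient.mkₐ K Q).comp G = g := by
      ext i
      simpa [G] using hp i
    intro P
    rw [← this]
    rfl
  have hsurj : ∀ t : Fin d → K, ∃ x ∈ Z, ∀ P, eval x (G P) = eval t P := by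
    refine fun t => exists_mem_zeroLocus_of_isIntegral G Q ?_ t fun P hP => ?_
    · have : (Ideal.Quotient.mk Q).comp G.toRingHom = g.toRingHom := RingHom.ext hG
      rw [this]
      exact hgint
    · rw [← Ideal.Quotient.eq_zero_iff_mem, hG, map_eq_zero_iff g hginj] at hP
      rw [hP, map_zero]
  -- the comorphism of the map `Z × Z → K^d × K^d`
  let q₀ : MvPolynomial (Fin d ⊕ Fin d) K →ₐ[K] MvPolynomial (τ ⊕ τ) K :=
    aeval (Sum.elim (fun i => rename Sum.inl (p i))
      fun i => rename Sum.inr (map (σ : K →+* K) (p i)))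
  let q : MvPolynomial (Fin d ⊕ Fin d) K →+* ev.range := ev.rangeRestrict.comp q₀.toRingHom
  have hq : ∀ P (x y : Z), (q P).1 (x, y) =
      eval (Sum.elim (fun i => eval x.1 (p i)) fun i => σ (eval y.1 (p i))) P := by
    intro P x y
    have : (q P).1 (x, y) = eval (Sum.elim x.1 fun t => σ (y.1 t)) (q₀ P) := rfl
    rw [this, eval_aeval_eq]
    congr 2
    funext i
    cases i
    · simp [eval_rename, Function.comp_def]
    · simp only [Sum.elim_inr, eval_rename]
      exact eval_map_ringEquiv σ y.1 _
  have hint : ∀ P, q.IsIntegralElem (ev.rangeRestrict P) := by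
    -- An integral equation over the `d` normalising variables is transported to either factor of
    -- the product, the second one with coefficients twisted by `σ`.
    have key : ∀ (l : MvPolynomial τ K →+* MvPolynomial (τ ⊕ τ) K)
        (r : MvPolynomial (Fin d) K →+* MvPolynomial (Fin d ⊕ Fin d) K),
        (∀ P ∈ Q, ev.rangeRestrict (l P) = 0) →
        (∀ P, ev.rangeRestrict (l (G P)) = q (r P)) →
        ∀ P, q.IsIntegralElem (ev.rangeRestrict (l P)) := by
      intro l r h0 hlr P
      have h1 := (hgint (Ideal.Quotient.mk Q P)).map
        (Ideal.Quotient.lift Q (ev.rangeRestrict.comp l) h0)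
      have h2 : (Ideal.Quotient.lift Q (ev.rangeRestrict.comp l) h0).comp g.toRingHom =
          q.comp r := by
        refine RingHom.ext fun P => ?_
        change Ideal.Quotient.lift Q (ev.rangeRestrict.comp l) h0 (g P) = _
        rw [← hG]
        exact hlr P
      rw [h2] at h1
      exact h1.of_comp
    have hl := key (rename Sum.inl).toRingHom (rename Sum.inl).toRingHom
      (fun P hP => by
        ext ⟨x, y⟩
        change eval _ (rename Sum.inl P) = 0
        rw [eval_rename]
        exact (hvan P).1 hP x.1 x.2)
      fun P => by
        ext ⟨x, y⟩
        rw [hq]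
        change eval _ (rename Sum.inl (G P)) = eval _ (rename Sum.inl P)
        rw [eval_rename, eval_rename]
        exact eval_aeval_eq _ _ _
    have hr := key ((rename Sum.inr).toRingHom.comp (map (σ : K →+* K)))
      ((rename Sum.inr).toRingHom.comp (map (σ : K →+* K)))
      (fun P hP => by
        ext ⟨x, y⟩
        change eval _ (rename Sum.inr (map (σ : K →+* K) P)) = 0
        rw [eval_rename]
        refine (eval_map_ringEquiv σ y.1 P).trans ?_
        rw [(hvan P).1 hP y.1 y.2, map_zero])
      fun P => by
        ext ⟨x, y⟩
        rw [hq]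
        change eval _ (rename Sum.inr (map (σ : K →+* K) (G P))) =
          eval _ (rename Sum.inr (map (σ : K →+* K) P))
        rw [eval_rename, eval_rename]
        refine (eval_map_ringEquiv σ y.1 (G P)).trans ?_
        refine Eq.trans ?_ (eval_map_ringEquiv σ (fun i => eval y.1 (p i)) P).symm
        rw [eval_aeval_eq]
    intro P
    induction P using MvPolynomial.induction_on with
    | C a =>
      have : q (C a) = ev.rangeRestrict (C a) := by
        simp [q, algebraMap_eq]
      rw [← this]
      exact RingHom.isIntegralElem_map _
    | add P P' hP hP' =>
      rw [map_add]
      exact hP.add _ hP'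
    | mul_X P t hP =>
      rw [map_mul]
      refine hP.mul _ ?_
      rcases t with t | t
      · simpa using hl (X t)
      · simpa using hr (X t)
  by_contra! hc
  obtain ⟨x, hx, y, hy, hxy⟩ := hc
  let _ := q.toAlgebra
  -- Since the second argument is conjugated in `ev`, restricting to the diagonal of `Z × Z` means
  -- restricting to the graph.
  let δ : ev.range →+* (Z → K) :=
      RingHom.pi fun x => (Pi.evalRingHom _ (x, x)).comp ev.range.subtype
  have hF0 : ev.rangeRestrict F ≠ 0 := by
    intro h0
    exact hxy (congrFun (congrArg Subtype.val h0) (⟨x, hx⟩, ⟨y, hy⟩))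
  have hFδ : ev.rangeRestrict F ∈ RingHom.ker δ := by
    rw [RingHom.mem_ker]
    funext x
    exact h x.1 x.2
  -- In a domain, an ideal containing a non-zero integral element has non-zero contraction.
  obtain ⟨P, hP, hP0⟩ := Submodule.exists_mem_ne_zero_of_ne_bot
    (Ideal.comap_ne_bot_of_integral_mem (R := MvPolynomial (Fin d ⊕ Fin d) K) hF0 hFδ (hint F))
  refine hP0 (eq_zero_of_eval_diag hσ hne fun t => ?_)
  obtain ⟨x, hx, hxt⟩ := hsurj t
  have h1 : (q P).1 (⟨x, hx⟩, ⟨x, hx⟩) = 0 :=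
    congrFun (RingHom.mem_ker.1 (Ideal.mem_comap.1 hP)) ⟨x, hx⟩
  rw [hq] at h1
  have h2 : ∀ i, eval x (p i) = t i := by
    intro i
    simpa [G] using hxt (X i)
  simpa only [h2] using h1

/-- The action of the involution on points. -/
def conj (σ : K ≃+* K) (v : ι → G K) : ι → G K :=
  fun j => G.mk (σ (v j).add) (Units.map (σ : K →* K) (v j).mul)

theorem coord_conj (σ : K ≃+* K) (v : ι → G K) : coord (conj σ v) = fun t => σ (coord v t) := by
  funext t
  cases t <;> rfl

theorem eval_rename_sumComm (x : ι → G K) (y : κ → G K)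
    (F : MvPolynomial ((ι ⊕ κ) ⊕ (ι ⊕ κ)) K) :
    eval (Sum.elim (coord x) (coord y)) (rename (Equiv.sumSumSumComm ι κ ι κ) F) =
      eval (coord (Sum.elim x y)) F := by
  rw [eval_rename]
  congr 2
  funext t
  rcases t with (t | t) | (t | t) <;> rfl

/-- The graph of the involution on an irreducible `W` is dense in the product of `W` with its
conjugate. -/
theorem regular_eq_zero_of_graph [IsAlgClosed K] [CharZero K] [Fintype ι] {σ : K ≃+* K}
    (hσ : ∀ x, σ (σ x) = x) (hne : ∃ x, σ x ≠ x) {Q : Ideal (MvPolynomial (ι ⊕ ι) K)} [Q.IsPrime]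
    {φ : (ι ⊕ ι → G K) → K} (hφ : φ ∈ regular K (ι ⊕ ι))
    (h : ∀ x ∈ coord ⁻¹' zeroLocus K Q, φ (Sum.elim x (conj σ x)) = 0) :
    ∀ x ∈ coord ⁻¹' zeroLocus K Q, ∀ y ∈ coord ⁻¹' zeroLocus K Q,
      φ (Sum.elim x (conj σ y)) = 0 := by
  obtain ⟨N, F, hF⟩ := hφ
  intro x hx y hy
  have key := eval_eq_zero_of_diag hσ hne (Q := Q)
    (F := rename Sum.inl (mulProdPoly K ι) * rename (Equiv.sumSumSumComm ι ι ι ι) F)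
    (fun x hx => by
      rw [map_mul, eval_rename]
      refine eval_mulProdPoly_mul_eq_zero (Q := Q) (f := fun x => Sum.elim x fun t => σ (x t))
        (fun v hv => ?_) hx
      rw [← coord_conj, eval_rename_sumComm, ← hF, h v hv, mul_zero])
    _ hx _ hy
  rw [map_mul, eval_rename, ← coord_conj, eval_rename_sumComm, ← hF] at key
  refine ((mul_eq_zero.1 ((mul_eq_zero.1 key).resolve_left ?_)).resolve_left ?_)
  · rw [Sum.elim_comp_inl, eval_mulProdPoly]
    exact mulProd_ne_zero _
  · exact pow_ne_zero _ (mulProd_ne_zero _)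

/-! ### Exponential polynomials -/

/-- The shift minus `α` sends `p(k) α ^ k` to `α (p(k + 1) - p(k)) α ^ k`, and the difference
operator lowers the degree of `p`. -/
theorem mem_maxGenEigenspace_shift (α : K) (p : Polynomial K) :
    (fun k : ℕ => p.eval (k : K) * α ^ k) ∈
      Module.End.maxGenEigenspace (LinearMap.funLeft K K Nat.succ) α := by
  rw [Module.End.mem_maxGenEigenspace]
  suffices h : ∀ (d : ℕ) (p : Polynomial K), p.degree < d →
      ((LinearMap.funLeft K K Nat.succ - α • (1 : Module.End K (ℕ → K))) ^ d)
        (fun k : ℕ => p.eval (k : K) * α ^ k) = 0 by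
    exact ⟨p.natDegree + 1, h _ p (Polynomial.degree_le_natDegree.trans_lt
      (by exact_mod_cast Nat.lt_succ_self _))⟩
  intro d
  induction d with
  | zero =>
    intro p hp
    have : p = 0 := by
      by_contra h0
      rw [Polynomial.degree_eq_natDegree h0] at hp
      exact absurd hp (by simp)
    funext k
    simp [this]
  | succ d ih =>
    intro p hp
    rw [pow_succ, Module.End.mul_apply]
    have h1 : (LinearMap.funLeft K K Nat.succ - α • (1 : Module.End K (ℕ → K)))
        (fun k : ℕ => p.eval (k : K) * α ^ k) =
        fun k : ℕ => (Polynomial.C α * (Polynomial.taylor 1 p - p)).eval (k : K) * α ^ k := by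
      funext k
      simp [LinearMap.funLeft_apply, Polynomial.taylor_eval, pow_succ]
      ring
    rw [h1]
    refine ih _ ?_
    by_cases h0 : p = 0
    · simp [h0]
    by_cases hα : α = 0
    · simp [hα]
    rw [Polynomial.degree_C_mul hα]
    have h2 : (Polynomial.taylor 1 p - p).degree < p.degree := by
      have := Polynomial.degree_sub_lt_left (p := Polynomial.taylor 1 p) (q := p)
        (Polynomial.degree_taylor _ _) (by simpa using h0) (by simp)
      rwa [Polynomial.degree_taylor] at this
    exact h2.trans_le (Order.lt_succ_iff.1 (by exact_mod_cast hp))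

/-- Generalised eigenspaces of the shift for distinct eigenvalues are independent. -/
theorem exp_poly_eq_zero {J : Type*} {T : Finset J} {α : J → K} (hα : Set.InjOn α T)
    {p : J → Polynomial K} (h : ∀ k : ℕ, ∑ t ∈ T, (p t).eval (k : K) * α t ^ k = 0) :
    ∀ t ∈ T, ∀ k : ℕ, (p t).eval (k : K) * α t ^ k = 0 := by
  have hind : iSupIndep fun t : T =>
      Module.End.maxGenEigenspace (LinearMap.funLeft K K Nat.succ) (α t) :=
    (Module.End.independent_maxGenEigenspace _).comp fun s t hst =>
      Subtype.ext (hα s.2 t.2 hst)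
  have := (iSupIndep_iff_finsetSum_eq_zero_imp_eq_zero _).1 hind Finset.univ
    (fun t k => (p t).eval (k : K) * α t ^ k) (fun t _ => mem_maxGenEigenspace_shift _ _) (by
      funext k
      rw [Finset.sum_apply, Pi.zero_apply, ← h k]
      exact Finset.sum_coe_sort T fun t => (p t).eval (k : K) * α t ^ k)
  exact fun t ht k => congrFun (this ⟨t, ht⟩ (Finset.mem_univ _)) k

theorem eval_eq_sum_optionEquivRight [Fintype ι] (F : MvPolynomial (Option ι) K) (a : K)
    (b : ι → K) : eval (fun t => Option.elim t a b) F =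
      ∑ m ∈ (optionEquivRight K ι F).support,
        ((optionEquivRight K ι F).coeff m).eval a * ∏ j, b j ^ m j := by
  have h : eval (fun t => Option.elim t a b) F =
      (eval (fun j => Polynomial.C (b j)) (optionEquivRight K ι F)).eval a := by
    induction F using MvPolynomial.induction_on with
    | C a => simp
    | add p q hp hq => simp only [map_add, hp, hq, Polynomial.eval_add]
    | mul_X p t hp =>
      simp only [map_mul, hp, Polynomial.eval_mul, eval_X]
      cases t <;> simp
  rw [h, eval_eq', Polynomial.eval_finsetSum]
  refine Finset.sum_congr rfl fun m _ => ?_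
  rw [Polynomial.eval_mul, Polynomial.eval_prod]
  simp

/-- A polynomial in one additive and all multiplicative coordinates which vanishes on a progression
`x + k s` with generic step `s` is zero. -/
theorem eq_zero_of_eval_progression [CharZero K] [Fintype ι] (x s : ι → G K) (j₀ : ι)
    (hs : (s j₀).add ≠ 0) {F : MvPolynomial (Option ι) K}
    (hα : Set.InjOn (fun m : ι →₀ ℕ => ∏ j, (s j).mul ^ m j) (optionEquivRight K ι F).support)
    (h : ∀ k : ℕ, eval (fun t => Option.elim t ((x + k • s) j₀).add
      fun j => (((x + k • s) j).mul : K)) F = 0) : F = 0 := by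
  -- Along the progression the monomial with exponent `m` is a constant times `α m ^ k`, and its
  -- coefficient is a polynomial in `k`.
  have key := exp_poly_eq_zero (K := K) (T := (optionEquivRight K ι F).support)
    (α := fun m => ((∏ j, (s j).mul ^ m j : Kˣ) : K))
    (p := fun m => ((optionEquivRight K ι F).coeff m).comp
      (Polynomial.C (x j₀).add + Polynomial.C (s j₀).add * Polynomial.X) *
        Polynomial.C (∏ j, ((x j).mul : K) ^ m j))
    (fun m hm m' hm' e => hα hm hm' (Units.ext e)) (fun k => by
      rw [← h k, eval_eq_sum_optionEquivRight]
      refine Finset.sum_congr rfl fun m _ => ?_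
      simp only [Polynomial.eval_mul, Polynomial.eval_comp, Polynomial.eval_add, Polynomial.eval_C,
        Polynomial.eval_X, Pi.add_apply, Pi.smul_apply, G.add_add, G.add_nsmul, G.mul_add,
        G.mul_nsmul, Units.val_mul, Units.val_pow_eq_pow_val, Units.coe_prod, mul_pow,
        Finset.prod_mul_distrib, ← Finset.prod_pow]
      rw [mul_assoc, mul_comm (s j₀).add]
      congr 2
      exact Finset.prod_congr rfl fun j _ => by rw [← pow_mul, ← pow_mul, mul_comm])
  have hP : optionEquivRight K ι F = 0 := by
    by_contra hne
    obtain ⟨m, hm⟩ := MvPolynomial.ne_zero_iff.1 hne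
    apply hm
    refine Polynomial.eq_zero_of_infinite_isRoot _ (Set.Infinite.mono (s := Set.range fun k : ℕ =>
      (x j₀).add + (s j₀).add * (k : K)) ?_ (Set.infinite_range_of_injective fun k l hkl => ?_))
    · rintro _ ⟨k, rfl⟩
      have := key m (mem_support_iff.2 hm) k
      rw [mul_eq_zero, or_iff_left (pow_ne_zero _ (Units.ne_zero _)), Polynomial.eval_mul,
        mul_eq_zero, Polynomial.eval_C, or_iff_left (Finset.prod_ne_zero_iff.2 fun j _ =>
          pow_ne_zero _ (Units.ne_zero _)), Polynomial.eval_comp] at this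
      simpa using this
    · exact Nat.cast_injective (mul_left_cancel₀ hs (add_left_cancel hkl))
  exact (optionEquivRight K ι).injective (hP.trans (map_zero _).symm)

/-! ### Free sets -/

/-- The additive character with integer weights `c`. -/
def addChar [Fintype ι] (c : ι → ℤ) (v : ι → G K) : K := ∑ j, (c j : K) * (v j).add

/-- The multiplicative character with integer weights `c`. -/
def mulChar [Fintype ι] (c : ι → ℤ) (v : ι → G K) : Kˣ := ∏ j, (v j).mul ^ c j

theorem matAct_apply_add [Fintype ι] (M : Matrix κ ι ℤ) (v : ι → G K) (i : κ) :
    (matAct M v i).add = addChar (M i) v := matAct_add M v i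

theorem matAct_apply_mul [Fintype ι] (M : Matrix κ ι ℤ) (v : ι → G K) (i : κ) :
    (matAct M v i).mul = mulChar (M i) v := matAct_mul M v i

theorem addChar_mem_regular [Fintype ι] (c : ι → ℤ) :
    (addChar c : (ι → G K) → K) ∈ regular K ι := by
  have := (isRegularMap_matAct (K := K) (Matrix.of fun _ : Fin 1 => c) 0).1
  simp only [matAct_apply_add] at this
  exact this

theorem mulChar_mem_regular [Fintype ι] (c : ι → ℤ) :
    (fun v : ι → G K => (mulChar c v : K)) ∈ regular K ι := by
  have := (isRegularMap_matAct (K := K) (Matrix.of fun _ : Fin 1 => c) 0).2.1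
  simp only [matAct_apply_mul] at this
  exact this

theorem addChar_matAct [Fintype ι] [Fintype κ] (M : Matrix κ ι ℤ) (c : κ → ℤ) (v : ι → G K) :
    addChar c (matAct M v) = addChar (Matrix.vecMul c M) v := by
  simp only [addChar, matAct_add, Matrix.vecMul, dotProduct, Int.cast_sum, Int.cast_mul,
    Finset.mul_sum, Finset.sum_mul, mul_assoc]
  exact Finset.sum_comm

theorem zpow_sum_eq_prod {τ H : Type*} [CommGroup H] (t : Finset τ) (a : H) (f : τ → ℤ) :
    a ^ ∑ i ∈ t, f i = ∏ i ∈ t, a ^ f i := by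
  classical
  induction t using Finset.induction_on with
  | empty => simp
  | insert i t hi ih => rw [Finset.sum_insert hi, Finset.prod_insert hi, zpow_add, ih]

theorem mulChar_matAct [Fintype ι] [Fintype κ] (M : Matrix κ ι ℤ) (c : κ → ℤ) (v : ι → G K) :
    mulChar c (matAct M v) = mulChar (Matrix.vecMul c M) v := by
  simp only [mulChar, matAct_mul, Matrix.vecMul, dotProduct, ← Finset.prod_zpow, ← zpow_mul,
    zpow_sum_eq_prod]
  rw [Finset.prod_comm]
  simp only [mul_comm (M _ _)]

theorem addChar_add_vec [Fintype ι] (c : ι → ℤ) (v w : ι → G K) :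
    addChar c (v + w) = addChar c v + addChar c w := by
  simp [addChar, mul_add, Finset.sum_add_distrib]

theorem mulChar_add_vec [Fintype ι] (c : ι → ℤ) (v w : ι → G K) :
    mulChar c (v + w) = mulChar c v * mulChar c w := by
  simp [mulChar, mul_zpow, Finset.prod_mul_distrib]

/-- No non-trivial additive or multiplicative character is constant on `S`. -/
def IsFreeSet [Fintype ι] (S : Set (ι → G K)) : Prop :=
  ∀ c : ι → ℤ, c ≠ 0 → (¬∃ a, ∀ v ∈ S, addChar c v = a) ∧ ¬∃ u, ∀ v ∈ S, mulChar c v = u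

theorem affDim_singleton {τ : Type} [Finite τ] (x : τ → K) : affDim {x} = 0 := by
  have : Algebra.IsAlgebraic K (MvPolynomial τ K ⧸ vanishingIdeal K {x}) := by
    refine ⟨fun a => ?_⟩
    obtain ⟨F, rfl⟩ := Ideal.Quotient.mk_surjective a
    have : Ideal.Quotient.mk (vanishingIdeal K {x}) F = algebraMap K _ (eval x F) := by
      rw [IsScalarTower.algebraMap_apply K (MvPolynomial τ K), Ideal.Quotient.algebraMap_eq,
        Ideal.Quotient.eq, mem_vanishingIdeal_singleton_iff]
      simp [aeval_eq_eval, algebraMap_eq]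
    rw [this]
    exact isAlgebraic_algebraMap _
  rw [affDim, trdeg_eq_zero, map_zero]

theorem affDim_eq_card_of_forall {τ : Type} [Fintype τ] {S : Set (τ → K)}
    (h : ∀ F : MvPolynomial τ K, (∀ x ∈ S, eval x F = 0) → F = 0) :
    affDim S = Fintype.card τ := by
  have h1 : vanishingIdeal K S = ⊥ := by
    rw [eq_bot_iff]
    intro F hF
    exact h F hF
  rw [affDim, h1, (AlgEquiv.quotientBot K (MvPolynomial τ K)).trdeg_eq,
    MvPolynomial.trdeg_of_isDomain]
  simp

theorem IsAbsolutelyFree.isFreeSet [Fintype ι] {S : Set (ι → G K)} (h : IsAbsolutelyFree S)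
    (hne : S.Nonempty) : IsFreeSet S := by
  intro c hc
  obtain ⟨h1, h2⟩ := h (Matrix.of fun _ => c) fun h0 => hc (congrFun h0 0)
  constructor
  · rintro ⟨a, ha⟩
    have : piA '' (matAct (Matrix.of fun _ : Fin 1 => c) '' S) = {fun _ => a} := by
      rw [← Set.image_comp, ← hne.image_const (fun _ : Fin 1 => a)]
      refine Set.image_congr fun v hv => funext fun i => ?_
      exact (matAct_apply_add _ _ _).trans (ha v hv)
    rw [this, affDim_singleton] at h1
    exact zero_ne_one h1
  · rintro ⟨a, ha⟩
    have : piM '' (matAct (Matrix.of fun _ : Fin 1 => c) '' S) = {fun _ => (a : K)} := by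
      rw [← Set.image_comp, ← hne.image_const (fun _ : Fin 1 => (a : K))]
      refine Set.image_congr fun v hv => funext fun i => ?_
      exact congrArg Units.val ((matAct_apply_mul _ _ _).trans (ha v hv))
    rw [this, affDim_singleton] at h2
    exact zero_ne_one h2

/-- A non-constant character on an irreducible set is transcendental, so the corresponding
projection has dimension one. -/
theorem IsFreeSet.isAbsolutelyFree [Fintype ι] {S : Set (ι → G K)} (h : IsFreeSet S)
    (hS : IsIrred S) : IsAbsolutelyFree S := by
  intro M hM
  have hc : M 0 ≠ 0 := by
    intro h0
    apply hM
    ext i j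
    rw [Subsingleton.elim i 0]
    exact congrFun h0 j
  obtain ⟨h1, h2⟩ := h _ hc
  constructor
  · rw [affDim_eq_card_of_forall, Fintype.card_fin]
    intro F hF
    refine hS.indepOn_of_not_const (addChar_mem_regular _) h1 (τ := Fin 1) F fun v hv => ?_
    rw [← hF _ ⟨_, ⟨v, hv, rfl⟩, rfl⟩]
    congr 2
    funext i
    rw [Subsingleton.elim i 0]
    exact (matAct_apply_add _ _ _).symm
  · rw [affDim_eq_card_of_forall, Fintype.card_fin]
    intro F hF
    have h2' : ¬∃ a : K, ∀ v ∈ S, (mulChar (M 0) v : K) = a := by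
      rintro ⟨c, hc⟩
      obtain ⟨v, hv⟩ := hS.1
      exact h2 ⟨mulChar (M 0) v, fun w hw => Units.ext ((hc w hw).trans (hc v hv).symm)⟩
    refine hS.indepOn_of_not_const (mulChar_mem_regular _) h2' (τ := Fin 1) F fun v hv => ?_
    rw [← hF _ ⟨_, ⟨v, hv, rfl⟩, rfl⟩]
    congr 2
    funext i
    rw [Subsingleton.elim i 0]
    exact congrArg Units.val (matAct_apply_mul _ _ _).symm

theorem IsFreeSet.image [Fintype ι] [Fintype κ] {S : Set (ι → G K)} (h : IsFreeSet S)
    {M : Matrix κ ι ℤ} (hM : ∀ c : κ → ℤ, Matrix.vecMul c M = 0 → c = 0) :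
    IsFreeSet (matAct M '' S) := by
  intro c hc
  simpa only [Set.forall_mem_image, addChar_matAct, mulChar_matAct] using
    h _ fun h0 => hc (hM c h0)

/-! ### Growth of dimension under sums -/

theorem isRegularMap_add_const [Fintype ι] (c : ι → G K) :
    IsRegularMap fun v : ι → G K => v + c :=
  isRegularMap_id.add (isRegularMap_const c)

theorem IsIrred.image2_add [Fintype ι] {X Y : Set (ι → G K)} (hX : IsIrred X) (hY : IsIrred Y) :
    IsIrred (Set.image2 (· + ·) X Y) := by
  classical
  have h := (hX.image2_sumElim hY).image
    (isRegularMap_matAct (Matrix.fromCols (1 : Matrix ι ι ℤ) (1 : Matrix ι ι ℤ)))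
  have h1 : ∀ x : ι → G K, matAct (1 : Matrix ι ι ℤ) x = x := fun x => by
    simpa using matAct_smul_one 1 x
  simpa only [Set.image_image2, matAct_fromCols, h1] using h

theorem indepOn_image_add_const {X : Set (ι → G K)} {τ : Type*} {e : τ → ι ⊕ ι}
    (h : IndepOn X fun i v => coord v (e i)) (y : ι → G K) :
    IndepOn ((fun v => v + y) '' X) fun i v => coord v (e i) := by
  intro F hF
  refine eq_zero_of_eval_affine h
    (a := fun i => Sum.elim (fun _ => 1) (fun j => ((y j).mul : K)) (e i))
    (b := fun i => Sum.elim (fun j => (y j).add) (fun _ => 0) (e i)) (fun i => ?_) fun x hx => ?_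
  · rcases e i with j | j <;> simp
  · refine Eq.trans (congrArg (fun c => eval c F) (funext fun i => ?_)) (hF _ ⟨x, hx, rfl⟩)
    beta_reduce
    generalize e i = t
    rcases t with j | j <;> simp [mul_comm]

/-- The translate `X + y₀` has full dimension in `X + Y`, hence is dense there. A function vanishing
on `X` therefore vanishes on `X + (y₁ - y₀)`, and this can be iterated. -/
theorem IsIrred.eq_zero_of_dim_image2_add_le [Fintype ι] {X Y : Set (ι → G K)} (hX : IsIrred X)
    (hY : IsIrred Y) (hd : dim (Set.image2 (· + ·) X Y) ≤ dim X) {φ : (ι → G K) → K}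
    (hφ : φ ∈ regular K ι) (h : ∀ x ∈ X, φ x = 0) {y₀ y₁ : ι → G K} (hy₀ : y₀ ∈ Y) (hy₁ : y₁ ∈ Y)
    (k : ℕ) : ∀ x ∈ X, φ (x + k • (y₁ - y₀)) = 0 := by
  have step : ∀ ψ ∈ regular K ι, (∀ x ∈ X, ψ x = 0) → ∀ x ∈ X, ψ (x + (y₁ - y₀)) = 0 := by
    intro ψ hψ h0 x hx
    obtain ⟨e, he⟩ := hX.exists_indepOn_coord
    have := (hX.image2_add hY).eq_zero_of_indepOn (S' := (fun v => v + y₀) '' X)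
      (by rintro _ ⟨x, hx, rfl⟩; exact ⟨x, hx, y₀, hy₀, rfl⟩)
      (fun i => coord_mem_regular (e i)) (indepOn_image_add_const he y₀) (by simpa using hd)
      ((isRegularMap_add_const (-y₀)).comp_mem hψ)
      (by rintro _ ⟨x, hx, rfl⟩; simpa using h0 x hx) (x + y₁) ⟨x, hx, y₁, hy₁, rfl⟩
    rwa [add_assoc, ← sub_eq_add_neg] at this
  induction k with
  | zero => simpa using h
  | succ k ih =>
    intro x hx
    have := step _ ((isRegularMap_add_const (k • (y₁ - y₀))).comp_mem hφ) ih x hx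
    rwa [add_assoc, add_comm (y₁ - y₀), ← succ_nsmul] at this

theorem mulChar_sub_weight [Fintype ι] (c d : ι → ℤ) (v : ι → G K) :
    mulChar (c - d) v = mulChar c v / mulChar d v := by
  simp [mulChar, zpow_sub, Finset.prod_mul_distrib, div_eq_mul_inv]

/-- A generic difference of two points of a free set separates finitely many monomials. -/
theorem IsFreeSet.exists_separating [Fintype ι] {Y : Set (ι → G K)} (h : IsFreeSet Y)
    (hY : IsIrred Y) (j₀ : ι) (T : Finset (ι →₀ ℕ)) {y₀ : ι → G K} :
    ∃ y₁ ∈ Y, ((y₁ - y₀) j₀).add ≠ 0 ∧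
      Set.InjOn (fun m : ι →₀ ℕ => ∏ j, ((y₁ - y₀) j).mul ^ m j) T := by
  classical
  have hc : ∀ (m : ι →₀ ℕ) (v : ι → G K),
      mulChar (fun j => (m j : ℤ)) v = ∏ j, (v j).mul ^ m j := fun m v => by simp [mulChar]
  let φ : (ι →₀ ℕ) × (ι →₀ ℕ) → (ι → G K) → K := fun p y =>
    mulChar (fun j => (p.1 j : ℤ)) (y + -y₀) - mulChar (fun j => (p.2 j : ℤ)) (y + -y₀)
  have hφ : ∀ p, φ p ∈ regular K ι := fun p =>
    sub_mem ((isRegularMap_add_const (-y₀)).comp_mem (mulChar_mem_regular _))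
      ((isRegularMap_add_const (-y₀)).comp_mem (mulChar_mem_regular _))
  by_contra! hcon
  -- If no `y₁` works, a finite product of regular functions vanishes on `Y`, so one factor does;
  -- each factor yields a character constant on `Y`.
  have key : ∀ y ∈ Y, ((y j₀).add - (y₀ j₀).add) * (∏ p ∈ T.offDiag, φ p) y = 0 := by
    intro y hy
    by_cases h0 : ((y - y₀) j₀).add = 0
    · rw [← G.add_sub, ← Pi.sub_apply, h0, zero_mul]
    · have := hcon y hy h0
      simp only [Set.InjOn, not_forall] at this
      obtain ⟨m, hm, m', hm', e, hne⟩ := this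
      rw [Finset.prod_apply, Finset.prod_eq_zero (i := (m, m')) (by simp_all), mul_zero]
      simp only [φ, hc, ← sub_eq_add_neg, e, sub_self]
  rcases hY.2 _ (sub_mem (add_mem_regular j₀) (const_mem_regular _)) _
    (prod_mem fun p _ => hφ p) key with h0 | h0
  · refine (h (Pi.single j₀ 1) (by simp)).1 ⟨(y₀ j₀).add, fun y hy => ?_⟩
    rw [← sub_eq_zero, ← h0 y hy]
    simp [addChar, Pi.single_apply]
  · obtain ⟨⟨m, m'⟩, hm, h1⟩ := hY.exists_forall_eq_zero_of_prod _ (fun p _ => hφ p) fun y hy => by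
      rw [← Finset.prod_apply]
      exact h0 y hy
    rw [Finset.mem_offDiag] at hm
    refine (h ((fun j => (m j : ℤ)) - fun j => (m' j : ℤ)) fun e => hm.2.2 ?_).2
      ⟨(mulChar ((fun j => (m j : ℤ)) - fun j => (m' j : ℤ)) (-y₀))⁻¹, fun y hy => ?_⟩
    · ext j
      have := congrFun e j
      simpa [sub_eq_zero] using this
    · rw [eq_inv_iff_mul_eq_one, ← mulChar_add_vec, mulChar_sub_weight, div_eq_one]
      exact Units.ext (sub_eq_zero.1 (h1 y hy))

theorem IsIrred.card_lt_dim_image2_add [CharZero K] [Fintype ι] {X Y : Set (ι → G K)}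
    (hX : IsIrred X) (hY : IsIrred Y) (hfree : IsFreeSet Y) (j₀ : ι) (hd : Fintype.card ι ≤ dim X) :
    Fintype.card ι < dim (Set.image2 (· + ·) X Y) := by
  by_contra! hle
  have hle' := hle.trans hd
  obtain ⟨y₀, hy₀⟩ := hY.1
  obtain ⟨x₀, hx₀⟩ := hX.1
  have hreg : ∀ t : Option ι,
      (fun v : ι → G K => Option.elim t (v j₀).add fun j => ((v j).mul : K)) ∈ regular K ι := by
    rintro (_ | j)
    · exact add_mem_regular j₀
    · exact mul_mem_regular j
  -- These are `n + 1` functions: one additive coordinate and all the multiplicative ones. The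
  -- generic step of the progression is chosen after `F`, to separate its finitely many monomials.
  have hind : IndepOn X fun (t : Option ι) v =>
      Option.elim t (v j₀).add fun j => ((v j).mul : K) := by
    intro F hF
    obtain ⟨y₁, hy₁, hs, hinj⟩ := hfree.exists_separating hY j₀ (optionEquivRight K ι F).support
      (y₀ := y₀)
    exact eq_zero_of_eval_progression x₀ (y₁ - y₀) j₀ hs hinj fun k =>
      hX.eq_zero_of_dim_image2_add_le hY hle' (eval_mem_regular hreg F) hF hy₀ hy₁ k x₀ hx₀
  have h2 := hX.card_le_dim hreg hind
  obtain ⟨e, he⟩ := hX.exists_indepOn_coord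
  have h3 : dim X ≤ dim (Set.image2 (· + ·) X Y) := by
    simpa using (hX.image2_add hY).card_le_dim (fun i => coord_mem_regular (e i))
      ((indepOn_image_add_const he y₀).mono (by rintro _ ⟨x, hx, rfl⟩; exact ⟨x, hx, y₀, hy₀, rfl⟩))
  rw [Fintype.card_option] at h2
  omega

/-! ### Rank bounds for images under integer matrices -/

/-- The images of `S` under all integer matrices satisfy the dimension bounds of a
simple variety. -/
def IsStronglyRotund [Fintype ι] (S : Set (ι → G K)) : Prop :=
  ∀ ⦃κ : Type⦄ [Fintype κ] (C : Matrix κ ι ℤ), C.rank ≤ dim (matAct C '' S) ∧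
    (0 < C.rank → C.rank < Fintype.card ι → C.rank < dim (matAct C '' S))

theorem IsSimple.isStronglyRotund [Fintype ι] {S : Set (ι → G K)} (h : IsSimple S)
    (hS : IsIrred S) : IsStronglyRotund S := by
  intro κ _ C
  have h1 : dim (matAct (C.transpose * C) '' S) ≤ dim (matAct C '' S) := by
    have := (hS.image (isRegularMap_matAct C)).dim_image_le (isRegularMap_matAct C.transpose)
    simpa only [Set.image_image, ← matAct_mul_mat] using this
  rw [← rank_transpose_mul_self_int C]
  exact ⟨(h.2.1 _).trans h1, fun h2 h3 => (h.2.2 _ h2 h3).trans_le h1⟩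

theorem IsStronglyRotund.of_dim_le [Fintype ι] {S S' : Set (ι → G K)} (h : IsStronglyRotund S)
    (hd : ∀ ⦃κ : Type⦄ [Fintype κ] (C : Matrix κ ι ℤ),
      dim (matAct C '' S) ≤ dim (matAct C '' S')) : IsStronglyRotund S' := fun _ _ C =>
  ⟨(h C).1.trans (hd C), fun h1 h2 => ((h C).2 h1 h2).trans_le (hd C)⟩

theorem IsIrred.dim_matAct_image_two_nsmul_le [Fintype ι] [Fintype κ] {S : Set (ι → G K)}
    (hS : IsIrred S) (C : Matrix κ ι ℤ) :
    dim (matAct C '' ((fun x : ι → G K => 2 • x) '' S)) ≤ dim (matAct C '' S) := by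
  have := (hS.image (isRegularMap_matAct C)).dim_image_le
    (h := fun x => x + x) (isRegularMap_id.add isRegularMap_id)
  simpa only [Set.image_image, two_nsmul, matAct_add_vec] using this

theorem IsFreeSet.of_two_nsmul [Fintype ι] {S : Set (ι → G K)}
    (h : IsFreeSet ((fun x : ι → G K => 2 • x) '' S)) : IsFreeSet S := by
  refine fun c hc => ⟨fun ⟨a, ha⟩ => (h c hc).1 ⟨a + a, ?_⟩, fun ⟨a, ha⟩ => (h c hc).2 ⟨a * a, ?_⟩⟩
  · rintro _ ⟨v, hv, rfl⟩
    simp only [two_nsmul, addChar_add_vec, ha v hv]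
  · rintro _ ⟨v, hv, rfl⟩
    simp only [two_nsmul, mulChar_add_vec, ha v hv]

/-! ### Conjugate sets -/

/-- Conjugation is only `σ`-semilinear; composing with `σ.symm` on the values restores regularity.
-/
theorem conj_comp_mem_regular [Fintype ι] (σ : K ≃+* K) {φ : (ι → G K) → K}
    (hφ : φ ∈ regular K ι) : (fun v => σ.symm (φ (conj σ v))) ∈ regular K ι := by
  obtain ⟨N, F, hF⟩ := hφ
  refine ⟨N, map (σ.symm : K →+* K) F, fun v => σ.injective ?_⟩
  rw [← eval_map_ringEquiv σ, map_map, ← coord_conj]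
  have h1 : map ((σ : K →+* K).comp (σ.symm : K →+* K)) F = F := by
    simp [MvPolynomial.map_id]
  have h2 : σ (mulProd v) = mulProd (conj σ v) := by
    simp [mulProd, conj]
  rw [h1, ← hF, map_mul, map_pow, h2, RingEquiv.apply_symm_apply]

theorem IsIrred.image_conj [Fintype ι] {S : Set (ι → G K)} (hS : IsIrred S) (σ : K ≃+* K) :
    IsIrred (conj σ '' S) := by
  refine ⟨hS.1.image _, fun φ hφ ψ hψ h => ?_⟩
  simp only [Set.forall_mem_image] at h ⊢
  have := hS.2 _ (conj_comp_mem_regular σ hφ) _ (conj_comp_mem_regular σ hψ) fun s hs => by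
    rw [← map_mul, h hs, map_zero]
  simpa using this

theorem IsIrred.dim_le_dim_image_conj [Fintype ι] {S : Set (ι → G K)} (hS : IsIrred S)
    (σ : K ≃+* K) : dim S ≤ dim (conj σ '' S) := by
  obtain ⟨e, he⟩ := hS.exists_indepOn_coord
  have h : IndepOn (conj σ '' S) fun i v => coord v (e i) := by
    intro F hF
    have h1 : map (σ.symm : K →+* K) F = 0 := by
      refine he _ fun s hs => σ.injective ?_
      rw [← eval_map_ringEquiv σ, map_map, map_zero, ← hF _ ⟨s, hs, rfl⟩]
      simp [MvPolynomial.map_id, coord_conj]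
    have h2 := congrArg (map (σ : K →+* K)) h1
    rw [map_map, map_zero] at h2
    simpa [MvPolynomial.map_id] using h2
  simpa using (hS.image_conj σ).card_le_dim (fun i => coord_mem_regular (e i)) h

theorem addChar_conj [Fintype ι] (σ : K ≃+* K) (c : ι → ℤ) (v : ι → G K) :
    addChar c (conj σ v) = σ (addChar c v) := by
  simp [addChar, conj]

theorem mulChar_conj [Fintype ι] (σ : K ≃+* K) (c : ι → ℤ) (v : ι → G K) :
    mulChar c (conj σ v) = Units.map (σ : K →* K) (mulChar c v) := by
  simp [mulChar, conj]

theorem matAct_conj [Fintype ι] (σ : K ≃+* K) (C : Matrix κ ι ℤ) (v : ι → G K) :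
    matAct C (conj σ v) = conj σ (matAct C v) := by
  funext i
  refine G.ext ?_ ?_
  · rw [matAct_apply_add, addChar_conj, ← matAct_apply_add]
    rfl
  · rw [matAct_apply_mul, mulChar_conj, ← matAct_apply_mul]
    rfl

theorem IsFreeSet.image_conj [Fintype ι] {S : Set (ι → G K)} (h : IsFreeSet S) (σ : K ≃+* K) :
    IsFreeSet (conj σ '' S) := by
  refine fun c hc => ⟨fun ⟨a, ha⟩ => (h c hc).1 ⟨σ.symm a, fun v hv => ?_⟩,
    fun ⟨a, ha⟩ => (h c hc).2 ⟨Units.map (σ.symm : K →* K) a, fun v hv => ?_⟩⟩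
  · rw [← ha _ ⟨v, hv, rfl⟩, addChar_conj, RingEquiv.symm_apply_apply]
  · rw [← ha _ ⟨v, hv, rfl⟩, mulChar_conj]
    ext
    simp

theorem IsIrred.dim_matAct_image_le_conj [Fintype ι] [Fintype κ] {S : Set (ι → G K)}
    (hS : IsIrred S) (σ : K ≃+* K) (C : Matrix κ ι ℤ) :
    dim (matAct C '' S) ≤ dim (matAct C '' (conj σ '' S)) := by
  have := (hS.image (isRegularMap_matAct C)).dim_le_dim_image_conj σ
  simpa only [Set.image_image, matAct_conj] using this

/-! ### The realisation of a double -/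

/-- The element `u * σ u` is positive, being the square of the modulus of `u`, so it is the positive
root of its own square. -/
theorem modulus_sq [IsAlgClosed K] [CharZero K] {σ : K ≃+* K} (hσ : ∀ x, σ (σ x) = x)
    (hne : ∃ x, σ x ≠ x) (u : Kˣ) : modulus σ (u ^ 2) = u * Units.map (σ : K →* K) u := by
  refine (modulus_unique hσ hne _ _ ?_ ?_).symm
  · obtain ⟨⟨s, hs0, hs, hs'⟩, h2⟩ := modulus_spec hσ hne u
    refine ⟨modulus σ u, Units.ne_zero _, ?_, ?_⟩
    · rw [hs', map_pow, hs]
    · rw [h2]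
      simp
  · simp [mul_pow]

theorem realise_two_nsmul [IsAlgClosed K] [CharZero K] {σ : K ≃+* K} (hσ : ∀ x, σ (σ x) = x)
    (hne : ∃ x, σ x ≠ x) (x : ι → G K) :
    realise σ (2 • x) = Sum.elim (x + conj σ x) (x - conj σ x) := by
  have h2 : σ 2 = 2 := map_ofNat σ 2
  have hm : ∀ u : Kˣ, modulus σ (u ^ 2) = u * Units.map (σ : K →* K) u := modulus_sq hσ hne
  funext t
  rcases t with j | j <;> refine G.ext ?_ ?_
  · simp [realise, realPart, conj, h2]
    field_simp
  · simp [realise, hm, conj]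
  · simp [realise, iImagPart, conj, h2]
    field_simp
  · simp only [realise, phase, conj, hm, Sum.elim_inr, Pi.smul_apply, Pi.sub_apply, G.mul_mk,
      G.mul_nsmul, G.mul_sub]
    rw [sq, mul_div_mul_left_eq_div]

/-! ### The restriction of scalars -/

theorem isRegularMap_add_sub [Fintype ι] : IsRegularMap fun p : ι ⊕ ι → G K =>
    Sum.elim (p ∘ Sum.inl + p ∘ Sum.inr) (p ∘ Sum.inl - p ∘ Sum.inr) := by
  classical
  have h := isRegularMap_sumElim
    (isRegularMap_matAct (K := K) (Matrix.fromCols (1 : Matrix ι ι ℤ) (1 : Matrix ι ι ℤ)))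
    (isRegularMap_matAct (K := K) (Matrix.fromCols (1 : Matrix ι ι ℤ)
        ((-1 : ℤ) • (1 : Matrix ι ι ℤ))))
  have h1 : ∀ x : ι → G K, matAct (1 : Matrix ι ι ℤ) x = x := fun x => by
    simpa using matAct_smul_one 1 x
  convert h using 2 with p
  rw [← Sum.elim_comp_inl_inr p, matAct_fromCols, matAct_fromCols, matAct_smul_one, h1, h1]
  simp [sub_eq_add_neg]

theorem gRestriction_two_nsmul [IsAlgClosed K] [CharZero K] [Fintype ι] {σ : K ≃+* K}
    (hσ : ∀ x, σ (σ x) = x) (hne : ∃ x, σ x ≠ x) {Q : Ideal (MvPolynomial (ι ⊕ ι) K)} [Q.IsPrime]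
    (hW : IsIrred (coord ⁻¹' zeroLocus K Q : Set (ι → G K))) {V : Set (ι → G K)}
    (hV : (fun x : ι → G K => 2 • x) '' (coord ⁻¹' zeroLocus K Q) = V) :
    IsIrred (gRestriction σ V) ∧ ∀ φ ∈ regular K (ι ⊕ ι), (∀ v ∈ gRestriction σ V, φ v = 0) →
      ∀ x ∈ (coord ⁻¹' zeroLocus K Q : Set (ι → G K)),
      ∀ y ∈ conj σ '' (coord ⁻¹' zeroLocus K Q), φ (Sum.elim (x + y) (x - y)) = 0 := by
  have hV' : realise σ '' V = (fun p : ι ⊕ ι → G K =>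
      Sum.elim (p ∘ Sum.inl + p ∘ Sum.inr) (p ∘ Sum.inl - p ∘ Sum.inr)) ''
        ((fun x => Sum.elim x (conj σ x)) '' (coord ⁻¹' zeroLocus K Q)) := by
    rw [← hV, Set.image_image, Set.image_image]
    refine Set.image_congr fun x _ => ?_
    rw [realise_two_nsmul hσ hne]
    rfl
  -- The graph inherits irreducibility from the product, in which it is dense.
  have hgraph : IsIrred ((fun x => Sum.elim x (conj σ x)) ''
      (coord ⁻¹' zeroLocus K Q : Set (ι → G K))) := by
    refine ⟨hW.1.image _, fun φ hφ ψ hψ h => ?_⟩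
    simp only [Set.forall_mem_image] at h ⊢
    have h1 := regular_eq_zero_of_graph hσ hne (mul_mem hφ hψ) fun x hx => h hx
    refine ((hW.image2_sumElim (hW.image_conj σ)).2 φ hφ ψ hψ ?_).imp ?_ ?_
    · rw [Set.forall_mem_image2]
      rintro x hx _ ⟨y, hy, rfl⟩
      exact h1 x hx y hy
    all_goals exact fun h2 x hx => h2 _ ⟨x, hx, _, ⟨x, hx, rfl⟩, rfl⟩
  have hirr := hgraph.image isRegularMap_add_sub
  rw [← hV'] at hirr
  refine ⟨isIrred_of_isIrreducible hirr.isIrreducible.closure, fun φ hφ h x hx y hy => ?_⟩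
  obtain ⟨y, hy, rfl⟩ := hy
  refine regular_eq_zero_of_graph hσ hne (isRegularMap_add_sub.comp_mem hφ)
      (fun x hx => ?_) x hx y hy
  refine h _ (subset_closure ?_)
  rw [hV']
  exact ⟨_, ⟨x, hx, rfl⟩, rfl⟩

/-! ### Lower bounds for the dimension of sums of images -/

theorem IsIrred.dim_le_of_forall_regular [Fintype ι] {S T : Set (ι → G K)} (hS : IsIrred S)
    (hT : IsIrred T) (h : ∀ φ ∈ regular K ι, (∀ t ∈ T, φ t = 0) → ∀ s ∈ S, φ s = 0) :
    dim S ≤ dim T := by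
  obtain ⟨e, he⟩ := hS.exists_indepOn_coord
  simpa using hT.card_le_dim (fun i => coord_mem_regular (e i)) fun F hF =>
    he F (h _ (eval_mem_regular (fun i => coord_mem_regular (e i)) F) hF)

/-- Applying `E` to `A x + B y` leaves a function of `y` alone. For fixed `y`, the coordinates of `A
x + B y` are invertible affine functions of those of `A x`, so `IndepOn.prod` combines the two
independent families. -/
theorem IsIrred.dim_add_dim_le {ι' : Type} [Fintype ι] [Fintype ι'] [Fintype κ] {S : Set (ι → G K)}
    {S' : Set (ι' → G K)} {T : Set (κ → G K)} (hS : IsIrred S) (hS' : IsIrred S') (hT : IsIrred T)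
    (A : Matrix κ ι ℤ) (B : Matrix κ ι' ℤ) (h : ∀ φ ∈ regular K κ, (∀ t ∈ T, φ t = 0) →
      ∀ x ∈ S, ∀ y ∈ S', φ (matAct A x + matAct B y) = 0) {E : Matrix κ κ ℤ} (hE : E * A = 0) :
    dim (matAct A '' S) + dim (matAct (E * B) '' S') ≤ dim T := by
  obtain ⟨e, he⟩ := (hS.image (isRegularMap_matAct A)).exists_indepOn_coord
  obtain ⟨e', he'⟩ := (hS'.image (isRegularMap_matAct (E * B))).exists_indepOn_coord
  have hf : IndepOn S fun i x => coord (matAct A x) (e i) :=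
    fun F hF => he F (Set.forall_mem_image.2 hF)
  have hg : IndepOn S' fun i y => coord (matAct (E * B) y) (e' i) :=
    fun F hF => he' F (Set.forall_mem_image.2 hF)
  have hprod := hf.prod hg
    (a := fun i y => Sum.elim (fun _ => 1) (fun j => ((matAct B y j).mul : K)) (e i))
    (b := fun i y => Sum.elim (fun j => (matAct B y j).add) (fun _ => 0) (e i))
    (fun i y => by rcases e i with j | j <;> simp)
  have hreg : ∀ t, Sum.elim (fun i v => coord v (e i)) (fun i v => coord (matAct E v) (e' i)) t ∈
      regular K κ := by
    rintro (i | i)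
    · exact coord_mem_regular (e i)
    · exact (isRegularMap_matAct E).comp_mem (coord_mem_regular (e' i))
  have := hT.card_le_dim hreg fun F hF => hprod F fun p hp => by
    refine Eq.trans (congrArg (fun c => eval c F) (funext fun t => ?_))
      (h _ (eval_mem_regular hreg F) hF p.1 hp.1 p.2 hp.2)
    rcases t with i | i
    · simp only [Sum.elim_inl]
      generalize e i = t
      rcases t with j | j <;> simp [mul_comm]
    · simp only [Sum.elim_inr]
      rw [matAct_add_vec, ← matAct_mul_mat, hE, matAct_zero_mat, zero_add, matAct_mul_mat]
  simpa using this

/-- A matrix of full column rank has a left inverse up to a non-zero integer `d`, and multiplication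
by `d` preserves independence of coordinates. -/
theorem IsIrred.dim_le_dim_matAct_image [IsAlgClosed K] [CharZero K] [Fintype ι] [Fintype κ]
    {S : Set (ι → G K)} (hS : IsIrred S) {C : Matrix κ ι ℤ} (hC : C.rank = Fintype.card ι) :
    dim S ≤ dim (matAct C '' S) := by
  classical
  obtain ⟨D, d, hd, hD⟩ := exists_leftInverse_of_rank_eq C hC
  have hDC : ∀ v : ι → G K, matAct D (matAct C v) = d • v := fun v => by
    rw [← matAct_mul_mat, hD, matAct_smul_one, natCast_zsmul]
  obtain ⟨e, he⟩ := hS.exists_indepOn_coord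
  have hreg : ∀ i, (fun v => coord (matAct D v) (e i)) ∈ regular K κ := fun i =>
    (isRegularMap_matAct D).comp_mem (coord_mem_regular (e i))
  have := (hS.image (isRegularMap_matAct C)).card_le_dim hreg fun F hF => by
    let g : Fin (dim S) → MvPolynomial (Fin (dim S)) K := fun i =>
      Sum.elim (fun _ => MvPolynomial.C (d : K) * X i) (fun _ => X i ^ d) (e i)
    have h1 : aeval g F = 0 := by
      refine he _ fun v hv => ?_
      rw [eval_aeval_eq, ← hF _ ⟨v, hv, rfl⟩]
      refine congrArg (fun c => eval c F) (funext fun i => ?_)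
      simp only [hDC, g]
      rcases hi : e i with j | j <;> simp [hi]
    refine MvPolynomial.funext fun c => ?_
    -- Every point `c` is reached by the maps `a ↦ d a` and `a ↦ a ^ d`, which are surjective on
    -- `K`.
    have h2 : ∀ i, ∃ a : K, Sum.elim (fun _ => (d : K) * a) (fun _ => a ^ d) (e i) = c i := by
      intro i
      rcases e i with j | j
      · exact ⟨(d : K)⁻¹ * c i, mul_inv_cancel_left₀ (Nat.cast_ne_zero.2 hd) _⟩
      · exact IsAlgClosed.exists_pow_nat_eq _ (Nat.pos_of_ne_zero hd)
    choose a ha using h2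
    have h3 := congrArg (eval a) h1
    rw [eval_aeval_eq, map_zero] at h3
    rw [map_zero, ← h3]
    refine congrArg (fun c => eval c F) (funext fun i => ?_)
    rw [← ha i]
    simp only [g]
    rcases e i with j | j <;> simp
  simpa using this

/-! ### Sets in which the sums and differences of two varieties are dense -/

/-- The product of `X` and `Y`, embedded by `(x, y) ↦ (x + y, x - y)`, is in the closure of `U`. -/
def IsSumDiffDense [Fintype ι] (U : Set (ι ⊕ ι → G K)) (X Y : Set (ι → G K)) : Prop :=
  ∀ φ ∈ regular K (ι ⊕ ι), (∀ v ∈ U, φ v = 0) → ∀ x ∈ X, ∀ y ∈ Y, φ (Sum.elim (x + y) (x - y)) = 0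

theorem addChar_sumDiff [Fintype ι] (c : ι ⊕ ι → ℤ) (x y : ι → G K) :
    addChar c (Sum.elim (x + y) (x - y)) =
      addChar (c ∘ Sum.inl + c ∘ Sum.inr) x + addChar (c ∘ Sum.inl - c ∘ Sum.inr) y := by
  simp only [addChar, Fintype.sum_sum_type, Sum.elim_inl, Sum.elim_inr, Pi.add_apply, Pi.sub_apply,
    G.add_add, G.add_sub, Function.comp_apply, ← Finset.sum_add_distrib, Int.cast_add, Int.cast_sub]
  exact Finset.sum_congr rfl fun j _ => by ring

theorem mulChar_sumDiff [Fintype ι] (c : ι ⊕ ι → ℤ) (x y : ι → G K) :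
    mulChar c (Sum.elim (x + y) (x - y)) =
      mulChar (c ∘ Sum.inl + c ∘ Sum.inr) x * mulChar (c ∘ Sum.inl - c ∘ Sum.inr) y := by
  simp only [mulChar, Fintype.prod_sum_type, Sum.elim_inl, Sum.elim_inr, Pi.add_apply, Pi.sub_apply,
    G.mul_add, G.mul_sub, Function.comp_apply, ← Finset.prod_mul_distrib, mul_zpow, div_zpow,
    zpow_add, zpow_sub]
  exact Finset.prod_congr rfl fun j _ => by simp only [div_eq_mul_inv]; ac_rfl

theorem IsSumDiffDense.isFreeSet [Fintype ι] {U : Set (ι ⊕ ι → G K)} {X Y : Set (ι → G K)}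
    (h : IsSumDiffDense U X Y) (hX : IsFreeSet X) (hY : IsFreeSet Y) (hXne : X.Nonempty)
    (hYne : Y.Nonempty) : IsFreeSet U := by
  intro c hc
  obtain ⟨x₀, hx₀⟩ := hXne
  obtain ⟨y₀, hy₀⟩ := hYne
  -- The weights on `x` and `y` are the sum and the difference of the two halves of `c`; both vanish
  -- only if `2c = 0`.
  have hc' : c ∘ Sum.inl + c ∘ Sum.inr ≠ 0 ∨ c ∘ Sum.inl - c ∘ Sum.inr ≠ 0 := by
    by_contra! h0
    apply hc
    funext t
    rcases t with j | j <;> have h1 := congrFun h0.1 j <;> have h2 := congrFun h0.2 j <;>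
      simp only [Pi.add_apply, Pi.sub_apply, Function.comp_apply, Pi.zero_apply] at h1 h2 ⊢ <;>
          omega
  constructor
  · rintro ⟨a, ha⟩
    have key : ∀ x ∈ X, ∀ y ∈ Y, addChar (c ∘ Sum.inl + c ∘ Sum.inr) x +
        addChar (c ∘ Sum.inl - c ∘ Sum.inr) y = a := by
      intro x hx y hy
      rw [← addChar_sumDiff]
      exact sub_eq_zero.1 (h _ (sub_mem (addChar_mem_regular c) (const_mem_regular a))
        (fun v hv => sub_eq_zero.2 (ha v hv)) x hx y hy)
    rcases hc' with h0 | h0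
    · exact (hX _ h0).1 ⟨_, fun x hx => eq_sub_of_add_eq (key x hx y₀ hy₀)⟩
    · exact (hY _ h0).1 ⟨_, fun y hy => eq_sub_of_add_eq' (key x₀ hx₀ y hy)⟩
  · rintro ⟨a, ha⟩
    have key : ∀ x ∈ X, ∀ y ∈ Y, mulChar (c ∘ Sum.inl + c ∘ Sum.inr) x *
        mulChar (c ∘ Sum.inl - c ∘ Sum.inr) y = a := by
      intro x hx y hy
      rw [← mulChar_sumDiff]
      exact Units.ext (sub_eq_zero.1 (h _
          (sub_mem (mulChar_mem_regular c) (const_mem_regular (a : K)))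
        (fun v hv => sub_eq_zero.2 (congrArg Units.val (ha v hv))) x hx y hy))
    rcases hc' with h0 | h0
    · exact (hX _ h0).2 ⟨_, fun x hx => eq_div_of_mul_eq' (key x hx y₀ hy₀)⟩
    · exact (hY _ h0).2 ⟨_, fun y hy => eq_div_of_mul_eq'' (key x₀ hx₀ y hy)⟩

theorem IsSumDiffDense.matAct_fromCols [Fintype ι] [Fintype κ] {U : Set (ι ⊕ ι → G K)}
    {X Y : Set (ι → G K)} (h : IsSumDiffDense U X Y) (N P : Matrix κ ι ℤ) {φ : (κ → G K) → K}
    (hφ : φ ∈ regular K κ) (h0 : ∀ t ∈ matAct (Matrix.fromCols N P) '' U, φ t = 0) :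
    ∀ x ∈ X, ∀ y ∈ Y, φ (matAct (N + P) x + matAct (N - P) y) = 0 := by
  intro x hx y hy
  rw [Set.forall_mem_image] at h0
  have := h _ ((isRegularMap_matAct (Matrix.fromCols N P)).comp_mem hφ)
      (fun v hv => h0 hv) x hx y hy
  rw [GRes.matAct_fromCols, matAct_add_vec, matAct_sub_vec] at this
  rw [← this, matAct_add_mat, matAct_sub_mat]
  congr 1
  abel

theorem IsSumDiffDense.dim_add_dim_le_left [Fintype ι] [Fintype κ] {U : Set (ι ⊕ ι → G K)}
    {X Y : Set (ι → G K)} (h : IsSumDiffDense U X Y) (hU : IsIrred U) (hX : IsIrred X)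
    (hY : IsIrred Y) (N P : Matrix κ ι ℤ) {E : Matrix κ κ ℤ} (hE : E * (N + P) = 0) :
    dim (matAct (N + P) '' X) + dim (matAct (E * (N - P)) '' Y) ≤
      dim (matAct (Matrix.fromCols N P) '' U) :=
  hX.dim_add_dim_le hY (hU.image (isRegularMap_matAct _)) _ _
      (fun _ hφ h0 => h.matAct_fromCols N P hφ h0) hE

theorem IsSumDiffDense.dim_add_dim_le_right [Fintype ι] [Fintype κ] {U : Set (ι ⊕ ι → G K)}
    {X Y : Set (ι → G K)} (h : IsSumDiffDense U X Y) (hU : IsIrred U) (hX : IsIrred X)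
    (hY : IsIrred Y) (N P : Matrix κ ι ℤ) {E : Matrix κ κ ℤ} (hE : E * (N - P) = 0) :
    dim (matAct (N - P) '' Y) + dim (matAct (E * (N + P)) '' X) ≤
      dim (matAct (Matrix.fromCols N P) '' U) :=
  hY.dim_add_dim_le hX (hU.image (isRegularMap_matAct _)) _ _
    (fun _ hφ h0 y hy x hx => by
      rw [add_comm]
      exact h.matAct_fromCols N P hφ h0 x hx y hy) hE

theorem IsSumDiffDense.isRotund [Fintype ι] {U : Set (ι ⊕ ι → G K)} {X Y : Set (ι → G K)}
    (h : IsSumDiffDense U X Y) (hU : IsIrred U) (hX : IsIrred X) (hY : IsIrred Y)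
    (hXr : IsStronglyRotund X) (hYr : IsStronglyRotund Y) : IsRotund U := by
  classical
  intro M
  rw [← Matrix.fromCols_toCols M]
  obtain ⟨E, hE, hr⟩ := exists_int_mul_eq_zero_rank_fromCols_le (M.toCols₁ + M.toCols₂)
    (M.toCols₁ - M.toCols₂)
  have h1 := h.dim_add_dim_le_left hU hX hY _ _ hE
  have h2 := (hXr (M.toCols₁ + M.toCols₂)).1
  have h3 := (hYr (E * (M.toCols₁ - M.toCols₂))).1
  have h4 := rank_fromCols_le_fromCols_add_sub M.toCols₁ M.toCols₂
  omega

/-! ### The equality case -/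

theorem IsStronglyRotund.rank_eq_zero_or_eq_card [Fintype ι] [Fintype κ] {S : Set (ι → G K)}
    (h : IsStronglyRotund S) {C : Matrix κ ι ℤ} (hC : dim (matAct C '' S) ≤ C.rank) :
    C.rank = 0 ∨ C.rank = Fintype.card ι := by
  have h1 := (h C).2
  have h2 := C.rank_le_card_width
  omega

theorem eq_zero_of_vecMul_eq_zero [Fintype ι] [Fintype κ] {B : Matrix κ ι ℤ}
    (h : B.rank = Fintype.card κ) (c : κ → ℤ) (hc : Matrix.vecMul c B = 0) : c = 0 := by
  classical
  have h1 : B.transpose.rank = Fintype.card κ := by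
    rw [← h, ← rank_toRat, ← rank_toRat B, ← Matrix.rank_transpose (toRat B)]
    rfl
  obtain ⟨D, d, hd, hD⟩ := exists_leftInverse_of_rank_eq _ h1
  have h2 : (D * B.transpose).mulVec c = 0 := by
    rw [← Matrix.mulVec_mulVec, Matrix.mulVec_transpose, hc, Matrix.mulVec_zero]
  rw [hD, Matrix.smul_mulVec, Matrix.one_mulVec] at h2
  exact (smul_eq_zero.1 h2).resolve_left (by exact_mod_cast hd)

theorem IsStronglyRotund.card_le_dim [Fintype ι] {S : Set (ι → G K)}
    (h : IsStronglyRotund S) (hS : IsIrred S) : Fintype.card ι ≤ dim S := by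
  classical
  have h1 := (h (1 : Matrix ι ι ℤ)).1
  rw [Matrix.rank_one] at h1
  exact h1.trans (hS.dim_image_le (isRegularMap_matAct _))

theorem IsSumDiffDense.rank_trichotomy [CharZero K] [Fintype ι] [Fintype κ]
    {U : Set (ι ⊕ ι → G K)} {X Y : Set (ι → G K)} (h : IsSumDiffDense U X Y) (hU : IsIrred U)
    (hX : IsIrred X) (hY : IsIrred Y) (hXr : IsStronglyRotund X) (hYr : IsStronglyRotund Y)
    (hYf : IsFreeSet Y) (N P : Matrix κ ι ℤ) (hpos : 0 < Fintype.card κ)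
    (hr : (Matrix.fromCols N P).rank = Fintype.card κ)
    (hd : dim (matAct (Matrix.fromCols N P) '' U) = Fintype.card κ) :
    (Fintype.card κ = 2 * Fintype.card ι ∧ (N + P).rank = Fintype.card ι ∧
        dim (matAct (N + P) '' X) = Fintype.card ι) ∨
      (Fintype.card κ = Fintype.card ι ∧ N = P ∧ (N + P).rank = Fintype.card ι ∧
        dim (matAct (N + P) '' X) = Fintype.card ι) ∨
      (Fintype.card κ = Fintype.card ι ∧ N = -P ∧ (N - P).rank = Fintype.card ι ∧
        dim (matAct (N - P) '' Y) = Fintype.card ι) := by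
  classical
  have h0 := rank_fromCols_le_fromCols_add_sub N P
  obtain ⟨E, hE, hE'⟩ := exists_int_mul_eq_zero_rank_fromCols_le (N + P) (N - P)
  obtain ⟨D, hD, hD'⟩ := exists_int_mul_eq_zero_rank_fromCols_le (N - P) (N + P)
  rw [rank_fromCols_comm] at hD'
  have h1 := h.dim_add_dim_le_left hU hX hY N P hE
  have h2 := h.dim_add_dim_le_right hU hX hY N P hD
  have h3 := (hXr (N + P)).1
  have h4 := (hYr (E * (N - P))).1
  have h5 := (hYr (N - P)).1
  have h6 := (hXr (D * (N + P))).1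
  -- The lower bound for the dimension now equals the row number, so every inequality in the chain
  -- is an equality; the same holds with the two factors exchanged.
  have ha := hXr.rank_eq_zero_or_eq_card (C := N + P) (by omega)
  have hb' := hYr.rank_eq_zero_or_eq_card (C := E * (N - P)) (by omega)
  have hb := hYr.rank_eq_zero_or_eq_card (C := N - P) (by omega)
  rcases ha with ha | ha
  · have hA := eq_zero_of_rank_eq_zero ha
    have h7 : (D * (N + P)).rank = 0 := by rw [hA, Matrix.mul_zero, Matrix.rank_zero]
    exact .inr (.inr ⟨by omega, eq_neg_of_add_eq_zero_left hA, by omega, by omega⟩)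
  rcases hb' with hb' | hb'
  · rcases hb with hb | hb
    · exact .inr (.inl ⟨by omega, sub_eq_zero.1 (eq_zero_of_rank_eq_zero hb), ha, by omega⟩)
    -- Here both `N + P` and `N - P` have rank `n`, which is also the row number, so the sum of the
    -- images has dimension greater than `n`, although it lies in the closure of a set of dimension
    -- `n`.
    · exfalso
      have hXA := hX.image (isRegularMap_matAct (N + P))
      have hYB := hY.image (isRegularMap_matAct (N - P))
      obtain ⟨k⟩ := Fintype.card_pos_iff.1 hpos
      have h7 := hXA.card_lt_dim_image2_add hYB
        (hYf.image (eq_zero_of_vecMul_eq_zero (B := N - P) (by omega))) k (by omega)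
      have h8 := (hXA.image2_add hYB).dim_le_of_forall_regular
        (hU.image (isRegularMap_matAct (Matrix.fromCols N P))) fun φ hφ h0 => by
          rintro _ ⟨_, ⟨x, hx, rfl⟩, _, ⟨y, hy, rfl⟩, rfl⟩
          exact h.matAct_fromCols N P hφ h0 x hx y hy
      omega
  · exact .inl ⟨by omega, ha, by omega⟩

theorem rank_smul_of_ne_zero [Fintype ι] (N : Matrix κ ι ℤ) {m : ℤ} (hm : m ≠ 0) :
    (m • N).rank = N.rank :=
  Matrix.rank_smul_of_mem_nonZeroDivisors N (mem_nonZeroDivisors_of_ne_zero hm)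

end GRes

end

theorem theorem9p1 {K : Type*} [Field K] [IsAlgClosed K] [CharZero K]
    (σ : K ≃+* K) (hσ : ∀ x, σ (σ x) = x) (hσ' : ∃ x, σ x ≠ x)
    (n : ℕ) (V : Set (Fin n → GRes.G K))
    (hV : GRes.IsAbsIrreducibleVariety V) (hVs : GRes.IsSimple V) :
    (GRes.IsAbsolutelyFree (GRes.gRestriction σ V) ∧
      GRes.IsAbsIrreducibleVariety (GRes.gRestriction σ V) ∧
      GRes.IsRotund (GRes.gRestriction σ V)) ∧
    ∀ (p : ℕ) (M : Matrix (Fin p) (Fin n ⊕ Fin n) ℤ), 0 < p → M.rank = p →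
      GRes.dim (GRes.matAct M '' GRes.gRestriction σ V) = M.rank →
      GRes.IsPerfectlyRotund V ∧
        (M.rank = 2 * n ∨
          (M.rank = n ∧ p = n ∧ ∃ N P : Matrix (Fin p) (Fin n) ℤ,
            M = Matrix.fromCols N P ∧ N.rank = n ∧ P.rank = n)) := by
  have hVi := GRes.isIrred_of_isIrreducible hV.2
  obtain ⟨Q, hQ, -, hW, hWV⟩ := GRes.exists_isIrred_double hVi hV.1
  obtain ⟨hU, hdense⟩ := GRes.gRestriction_two_nsmul hσ hσ' hW hWV
  set W : Set (Fin n → GRes.G K) := GRes.coord ⁻¹' MvPolynomial.zeroLocus K Q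
  have hdense : GRes.IsSumDiffDense (GRes.gRestriction σ V) W (GRes.conj σ '' W) := hdense
  have hW' := hW.image_conj σ
  have hVW : ∀ ⦃κ : Type⦄ [Fintype κ] (C : Matrix κ (Fin n) ℤ),
      GRes.dim (GRes.matAct C '' V) ≤ GRes.dim (GRes.matAct C '' W) := fun κ _ C => by
    rw [← hWV]
    exact hW.dim_matAct_image_two_nsmul_le C
  have hWW' : ∀ ⦃κ : Type⦄ [Fintype κ] (C : Matrix κ (Fin n) ℤ),
      GRes.dim (GRes.matAct C '' W) ≤ GRes.dim (GRes.matAct C '' (GRes.conj σ '' W)) :=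
    fun κ _ C => hW.dim_matAct_image_le_conj σ C
  have hVr := hVs.isStronglyRotund hVi
  have hWr := hVr.of_dim_le hVW
  have hWr' := hWr.of_dim_le hWW'
  have hWf : GRes.IsFreeSet W := by
    refine GRes.IsFreeSet.of_two_nsmul ?_
    rw [hWV]
    exact hVs.1.isFreeSet hVi.1
  have hWf' := hWf.image_conj σ
  refine ⟨⟨(hdense.isFreeSet hWf hWf' hW.1 hW'.1).isAbsolutelyFree hU,
    ⟨isClosed_closure, hU.isIrreducible⟩, hdense.isRotund hU hW hW' hWr hWr'⟩, ?_⟩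
  intro p M hp hr hd
  obtain ⟨N, P, rfl⟩ : ∃ N P : Matrix (Fin p) (Fin n) ℤ, M = Matrix.fromCols N P :=
    ⟨_, _, (Matrix.fromCols_toCols M).symm⟩
  have key := hdense.rank_trichotomy hU hW hW' hWr hWr' hWf' N P (by simpa using hp)
    (by simpa using hr) (by simpa using hd.trans hr)
  simp only [Fintype.card_fin] at key
  -- A matrix of rank `n` does not lower the dimension of `V`, so `dim V ≤ n`; rotundity gives the
  -- reverse inequality.
  have hperf : (∃ C : Matrix (Fin p) (Fin n) ℤ, C.rank = n ∧ GRes.dim (GRes.matAct C '' V) ≤ n) →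
      GRes.IsPerfectlyRotund V := by
    rintro ⟨C, hC, hC'⟩
    have h1 := hVr.card_le_dim hVi
    have h2 := hVi.dim_le_dim_matAct_image (C := C) (by simpa using hC)
    refine ⟨hVs, ?_⟩
    rw [GRes.depth]
    rw [Fintype.card_fin] at *
    omega
  rcases key with ⟨h1, h2, h3⟩ | ⟨h1, rfl, h2, h3⟩ | ⟨h1, rfl, h2, h3⟩
  · exact ⟨hperf ⟨_, h2, (hVW _).trans h3.le⟩, .inl (hr.trans h1)⟩
  · refine ⟨hperf ⟨_, h2, (hVW _).trans h3.le⟩, .inr ⟨hr.trans h1, h1, _, _, rfl, ?_⟩⟩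
    rw [← two_zsmul, GRes.rank_smul_of_ne_zero _ two_ne_zero] at h2
    exact ⟨h2, h2⟩
  · refine ⟨hperf ⟨_, h2, ((hVW _).trans (hWW' _)).trans h3.le⟩,
      .inr ⟨hr.trans h1, h1, _, _, rfl, ?_⟩⟩
    have h4 : -P - P = (-2 : ℤ) • P := by
      rw [neg_smul, two_zsmul]
      abel
    rw [h4, GRes.rank_smul_of_ne_zero _ (by norm_num)] at h2
    rw [← neg_one_zsmul, GRes.rank_smul_of_ne_zero _ (by norm_num)]
    exact ⟨h2, h2⟩
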